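/- For a bit string $x=(x_1,\dots,x_n)\in\{0,1\}^n$ let $\pi_x\in\operatorname{Sym}(2^n)$ be the simple butterfly permutation, built recursively from the trivial permutation of one point by $\pi_{(x_1,\dots,x_{j})}=\tau^{x_j}\otimes\pi_{(x_1,\dots,x_{j-1})}$, where $\tau=(1\ 2)$ and $\otimes$ is the Kronecker product of permutations (permutation matrices); that is, $\pi_{(x_1,\dots,x_j)}$ is the direct sum (if $x_j=0$) or the skew sum (if $x_j=1$) of two copies of $\pi_{(x_1,\dots,x_{j-1})}$. Let $\mathcal T(x)$ be the simple butterfly tree of $x$, i.e. the binary search tree with $2^n$ nodes obtained by inserting the keys $\pi_x(1),\pi_x(2),\dots,\pi_x(2^n)$ in this order. The Horton–Strahler number $\operatorname{HS}$ of a nonempty binary tree is the number of its root, where a leaf has number $0$, a node with exactly one child has the number of that child, and a node with children numbered $a,b$ has number $\max(a,b)+\mathbf 1_{a=b}$. Let $x$ be uniformly distributed on $\{0,1\}^n$, so that $\mathcal T^{\mathrm B}_n=\mathcal T(x)$ is a uniform simple butterfly tree with $2^n$ nodes, and put $\mu_n=\mathbb E\operatorname{HS}(\mathcal T^{\mathrm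 B}_n)$, $\sigma_n^2=\operatorname{Var}(\operatorname{HS}(\mathcal T^{\mathrm B}_n))$. Then $\sigma_n>0$ for all $n\ge 2$, and $$Z_n:=\frac{\operatorname{HS}(\mathcal T^{\mathrm B}_n)-\mu_n}{\sigma_n}\ \xrightarrow[n\to\infty]{d}\ \mathcal N(0,1).$$ Moreover, there is a constant $C$ such that for all $n\ge 2$ $$\sup_{t\in\mathbb R}\bigl|\mathbb P(Z_n\le t)-\Phi(t)\bigr|\le\frac{C}{\sqrt n},$$ where $\Phi$ is the distribution function of the standard normal law $\mathcal N(0,1)$. -/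

import Mathlib

open MeasureTheory ProbabilityTheory Filter

namespace Butterfly

/-- The Horton-Strahler number of a binary tree. A leaf has number `0`, a node with exactly one
child takes the number of that child, and a node with two children takes the maximum of the two
numbers, plus one if they are equal. (The value at the empty tree is a convention which is never
used at a node.) -/
def hortonStrahler {α : Type*} : BinaryTree α → ℕ
  | .nil => 0
  | .node _ .nil .nil => 0
  | .node _ (.node a l r) .nil => hortonStrahler (.node a l r)
  | .node _ .nil (.node b l r) => hortonStrahler (.node b l r)
  | .node _ (.node a l r) (.node b l' r') =>
      max (hortonStrahler (.node a l r)) (hortonStrahler (.node b l' r')) +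
        if hortonStrahler (.node a l r) = hortonStrahler (.node b l' r') then 1 else 0

/-- Insertion of a key into a binary search tree. -/
def bstInsert {α : Type*} [LinearOrder α] (k : α) : BinaryTree α → BinaryTree α
  | .nil => .node k .nil .nil
  | .node a l r =>
      if k < a then .node a (bstInsert k l) r
      else if a < k then .node a l (bstInsert k r)
      else .node a l r

/-- The binary search tree of a permutation `π`: the keys `π 0, π 1, …` are inserted in this
order into the empty tree. -/
def bst {m : ℕ} (π : Equiv.Perm (Fin m)) : BinaryTree (Fin m) :=
  (List.ofFn π).foldl (fun t k => bstInsert k t) .nil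

/-- The Kronecker product of permutations, i.e. the permutation whose permutation matrix is the
Kronecker product of those of `π` and `ρ`: it maps `n * i + j` to `n * π i + ρ j`. -/
def kronPerm {m n : ℕ} (π : Equiv.Perm (Fin m)) (ρ : Equiv.Perm (Fin n)) :
    Equiv.Perm (Fin (m * n)) :=
  finProdFinEquiv.permCongr (Equiv.prodCongr π ρ)

/-- The simple butterfly permutation of length `2 ^ n` with bit string `x`, the `n`-fold Kronecker
product of the permutations `τ ^ x j`, where `τ` is the transposition on two points. The `j`-th bit
decides the `j`-th step: with `π` the previous permutation, `1 ⊗ π` is the direct sum of two copies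
of `π`, and `τ ⊗ π` is their skew sum. -/
def simplePerm : (n : ℕ) → (Fin n → Bool) → Equiv.Perm (Fin (2 ^ n))
  | 0, _ => 1
  | n + 1, x =>
      (finCongr (show 2 * 2 ^ n = 2 ^ (n + 1) by rw [pow_succ, mul_comm])).permCongr
        (kronPerm (if x (Fin.last n) then Equiv.swap (0 : Fin 2) 1 else 1)
          (simplePerm n (Fin.init x)))

/-- The simple butterfly tree with bit string `x`; it has `2 ^ n` nodes. -/
def simpleTree {n : ℕ} (x : Fin n → Bool) : BinaryTree (Fin (2 ^ n)) :=
  bst (simplePerm n x)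

/-- The law of `n` independent fair bits, i.e. the uniform distribution on bit strings of
length `n`. -/
noncomputable def bits (n : ℕ) : Measure (Fin n → Bool) :=
  (PMF.uniformOfFintype (Fin n → Bool)).toMeasure

instance (n : ℕ) : IsProbabilityMeasure (bits n) := by
  unfold bits; infer_instance

/-- The Horton-Strahler number of the uniform simple butterfly tree with `2 ^ n` nodes, as a real
random variable on the space of bit strings. -/
def HS (n : ℕ) (x : Fin n → Bool) : ℝ := (hortonStrahler (simpleTree x) : ℝ)

/-- The mean of the Horton-Strahler number. -/
noncomputable def mean (n : ℕ) : ℝ := ∫ x, HS n x ∂(bits n)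

/-- The standard deviation of the Horton-Strahler number. -/
noncomputable def sd (n : ℕ) : ℝ := √(variance (HS n) (bits n))

/-- The normalized Horton-Strahler number. -/
noncomputable def Z (n : ℕ) (x : Fin n → Bool) : ℝ := (HS n x - mean n) / sd n

end Butterfly

/-! The Horton–Strahler number is read off the bits by a three-state automaton. A direct sum grafts
a second copy of the tree at the end of the right spine, a skew sum at the end of the left spine.
Call a spine light if every subtree hanging off it is empty or has number below the number `h` of
the whole tree; grafting a copy along a light spine keeps `h`. Starting with both spines light, one
bit makes the root's child on the grafted side heavy (number `h`). Repeating that bit changes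
nothing; the opposite bit gives the root two children of number `h`, so the number rises to `h + 1`
and both spines are light again (`hasState_step`).

For uniform bits the increments thus form a renewal process with waiting times one plus a
geometric(1/2) variable (mean 3, variance 2), whence mean ~ `n / 3` and variance ~ `2 * n / 27`;
exact formulas come from the two-step recursion `hsAvg`. Moreover the `k`-th increment occurs by
time `n` iff `n - k` fair tosses contain at least `k` successes, so P(HS ≥ k) is a binomial tail
(`hsAvg_tail`).

It remains to prove a Berry–Esseen bound for the simple random walk and to transfer it. The former
is Stein's method: the identity `walk_succ_mul` turns the error into that of a trapezoidal rule for
the derivative of the Stein solution, which is O(1/√m) except near the jump, where the walk is with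
probability O(1/√m) (`walk_near_le`). In the transfer the walk has `n - k` steps, so its variance
depends on `k`; Gaussian decay absorbs the discrepancy. Weak convergence follows from the uniform
bound. -/

namespace Butterfly

variable {α β : Type*}

/-! ### Search trees of direct and skew sums -/

/-- Graft a tree at the end of the right spine of another tree. -/
def graftRight : BinaryTree α → BinaryTree α → BinaryTree α
  | .nil, s => s
  | .node a l r, s => .node a l (graftRight r s)

/-- Graft a tree at the end of the left spine of another tree. -/
def graftLeft : BinaryTree α → BinaryTree α → BinaryTree α
  | .nil, s => s
  | .node a l r, s => .node a (graftLeft l s) r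

/-- A predicate holds for all the keys of a tree. -/
def AllKeys (p : α → Prop) : BinaryTree α → Prop
  | .nil => True
  | .node a l r => p a ∧ AllKeys p l ∧ AllKeys p r

/-- Insertion of a list of keys into a binary search tree. -/
def insertList [LinearOrder α] (t : BinaryTree α) (l : List α) : BinaryTree α :=
  l.foldl (fun t k => bstInsert k t) t

@[simp] lemma insertList_nil [LinearOrder α] (t : BinaryTree α) : insertList t [] = t := rfl

@[simp] lemma insertList_cons [LinearOrder α] (t : BinaryTree α) (k : α) (l : List α) :
    insertList t (k :: l) = insertList (bstInsert k t) l := rfl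

lemma insertList_append [LinearOrder α] (t : BinaryTree α) (l₁ l₂ : List α) :
    insertList t (l₁ ++ l₂) = insertList (insertList t l₁) l₂ := by
  simp [insertList]

lemma map_bstInsert [LinearOrder α] [LinearOrder β] {f : α → β} (hf : StrictMono f) (k : α)
    (t : BinaryTree α) : (bstInsert k t).map f = bstInsert (f k) (t.map f) := by
  induction t with
  | nil => rfl
  | node a l r ihl ihr =>
    simp only [bstInsert, BinaryTree.map, hf.lt_iff_lt]
    split_ifs <;> simp [BinaryTree.map, ihl, ihr]

lemma map_insertList [LinearOrder α] [LinearOrder β] {f : α → β} (hf : StrictMono f) (l : List α)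
    (t : BinaryTree α) : (insertList t l).map f = insertList (t.map f) (l.map f) := by
  induction l generalizing t with
  | nil => rfl
  | cons k l ih => simp [ih, map_bstInsert hf]

lemma allKeys_bstInsert [LinearOrder α] {p : α → Prop} {k : α} (hk : p k) {t : BinaryTree α}
    (ht : AllKeys p t) : AllKeys p (bstInsert k t) := by
  induction t with
  | nil => exact ⟨hk, trivial, trivial⟩
  | node a l r ihl ihr =>
    obtain ⟨h1, h2, h3⟩ := ht
    simp only [bstInsert]
    split_ifs
    · exact ⟨h1, ihl h2, h3⟩
    · exact ⟨h1, h2, ihr h3⟩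
    · exact ⟨h1, h2, h3⟩

lemma allKeys_insertList [LinearOrder α] {p : α → Prop} {l : List α} (hl : ∀ k ∈ l, p k)
    {t : BinaryTree α} (ht : AllKeys p t) : AllKeys p (insertList t l) := by
  induction l generalizing t with
  | nil => exact ht
  | cons k l ih =>
    exact ih (fun j hj => hl j (by simp [hj])) (allKeys_bstInsert (hl k (by simp)) ht)

/-- A key above all keys of `t` walks down the whole right spine of `t` before it meets `s`. -/
lemma bstInsert_graftRight [LinearOrder α] {k : α} {t : BinaryTree α} (ht : AllKeys (· < k) t)
    (s : BinaryTree α) : bstInsert k (graftRight t s) = graftRight t (bstInsert k s) := by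
  induction t with
  | nil => rfl
  | node a l r ihl ihr =>
    obtain ⟨h1, -, h3⟩ := ht
    simp [graftRight, bstInsert, h1, not_lt_of_gt h1, ihr h3]

lemma bstInsert_graftLeft [LinearOrder α] {k : α} {t : BinaryTree α} (ht : AllKeys (k < ·) t)
    (s : BinaryTree α) : bstInsert k (graftLeft t s) = graftLeft t (bstInsert k s) := by
  induction t with
  | nil => rfl
  | node a l r ihl ihr =>
    obtain ⟨h1, h2, -⟩ := ht
    simp [graftLeft, bstInsert, h1, ihl h2]

lemma graftRight_nil (t : BinaryTree α) : graftRight t .nil = t := by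
  induction t with
  | nil => rfl
  | node a l r _ ihr => simp [graftRight, ihr]

lemma graftLeft_nil (t : BinaryTree α) : graftLeft t .nil = t := by
  induction t with
  | nil => rfl
  | node a l r ihl _ => simp [graftLeft, ihl]

lemma insertList_graftRight [LinearOrder α] {l : List α} {t : BinaryTree α}
    (ht : ∀ k ∈ l, AllKeys (· < k) t) (s : BinaryTree α) :
    insertList (graftRight t s) l = graftRight t (insertList s l) := by
  induction l generalizing s with
  | nil => rfl
  | cons k l ih =>
    simp only [insertList_cons, bstInsert_graftRight (ht k (by simp))]
    exact ih (fun j hj => ht j (by simp [hj])) _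

lemma insertList_graftLeft [LinearOrder α] {l : List α} {t : BinaryTree α}
    (ht : ∀ k ∈ l, AllKeys (k < ·) t) (s : BinaryTree α) :
    insertList (graftLeft t s) l = graftLeft t (insertList s l) := by
  induction l generalizing s with
  | nil => rfl
  | cons k l ih =>
    simp only [insertList_cons, bstInsert_graftLeft (ht k (by simp))]
    exact ih (fun j hj => ht j (by simp [hj])) _

/-- Inserting a block of keys and then a block of larger keys. -/
lemma insertList_append_of_lt [LinearOrder α] {l₁ l₂ : List α}
    (h : ∀ k ∈ l₂, ∀ j ∈ l₁, j < k) :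
    insertList .nil (l₁ ++ l₂) = graftRight (insertList .nil l₁) (insertList .nil l₂) := by
  rw [insertList_append, ← insertList_graftRight, graftRight_nil]
  exact fun k hk => allKeys_insertList (h k hk) trivial

/-- Inserting a block of keys and then a block of smaller keys. -/
lemma insertList_append_of_gt [LinearOrder α] {l₁ l₂ : List α}
    (h : ∀ k ∈ l₂, ∀ j ∈ l₁, k < j) :
    insertList .nil (l₁ ++ l₂) = graftLeft (insertList .nil l₁) (insertList .nil l₂) := by
  rw [insertList_append, ← insertList_graftLeft, graftLeft_nil]
  exact fun k hk => allKeys_insertList (h k hk) trivial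

/-! ### The key sequence of a simple butterfly permutation -/

/-- The values of the simple butterfly permutation as natural numbers. -/
def keys (n : ℕ) (x : Fin n → Bool) : List ℕ :=
  List.ofFn fun i => (simplePerm n x i : ℕ)

lemma lt_of_mem_keys {n : ℕ} {x : Fin n → Bool} {k : ℕ} (hk : k ∈ keys n x) : k < 2 ^ n := by
  obtain ⟨i, rfl⟩ := (List.mem_ofFn' _ _).1 hk
  exact (simplePerm n x i).2

lemma map_val_simpleTree {n : ℕ} (x : Fin n → Bool) :
    (simpleTree x).map Fin.val = insertList .nil (keys n x) := by
  have := map_insertList (f := (Fin.val : Fin (2 ^ n) → ℕ)) (fun _ _ h => h)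
    (List.ofFn (simplePerm n x)) .nil
  rw [List.map_ofFn] at this
  exact this

lemma val_simplePerm_succ (n : ℕ) (x : Fin (n + 1) → Bool) (i : Fin (2 ^ (n + 1))) (a : Fin 2)
    (b : Fin (2 ^ n)) (h : (i : ℕ) = 2 ^ n * a + b) :
    (simplePerm (n + 1) x i : ℕ) =
      2 ^ n * (if x (Fin.last n) then Equiv.swap (0 : Fin 2) 1 else 1) a +
        simplePerm n (Fin.init x) b := by
  have hi : i = finCongr (show 2 * 2 ^ n = 2 ^ (n + 1) by rw [pow_succ, mul_comm])
      (finProdFinEquiv (a, b)) := by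
    ext; simp [h, finProdFinEquiv, add_comm]
  subst hi
  simp only [simplePerm, kronPerm, Equiv.permCongr_apply, Equiv.symm_apply_apply,
    Equiv.prodCongr_apply, Prod.map]
  simp [finProdFinEquiv, add_comm]

lemma keys_succ (n : ℕ) (x : Fin (n + 1) → Bool) :
    keys (n + 1) x = if x (Fin.last n)
      then (keys n (Fin.init x)).map (2 ^ n + ·) ++ keys n (Fin.init x)
      else keys n (Fin.init x) ++ (keys n (Fin.init x)).map (2 ^ n + ·) := by
  have h2 : 2 ^ (n + 1) = 2 ^ n + 2 ^ n := by ring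
  have e : keys (n + 1) x =
      (List.ofFn fun b : Fin (2 ^ n) => 2 ^ n *
        ((if x (Fin.last n) then Equiv.swap (0 : Fin 2) 1 else 1) 0 : Fin 2).val +
          (simplePerm n (Fin.init x) b : ℕ)) ++
      (List.ofFn fun b : Fin (2 ^ n) => 2 ^ n *
        ((if x (Fin.last n) then Equiv.swap (0 : Fin 2) 1 else 1) 1 : Fin 2).val +
          (simplePerm n (Fin.init x) b : ℕ)) := by
    rw [keys, List.ofFn_congr h2, List.ofFn_add]
    congr 2 <;> funext b <;> apply val_simplePerm_succ <;> simp [add_comm]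
  rw [e]
  split_ifs <;> simp [keys, List.map_ofFn, Function.comp_def]

/-! ### Horton–Strahler numbers and light spines under grafting -/

lemma hortonStrahler_map (f : α → β) (t : BinaryTree α) :
    hortonStrahler (t.map f) = hortonStrahler t := by
  induction t with
  | nil => rfl
  | node a l r ihl ihr =>
    cases l <;> cases r <;> simp_all [BinaryTree.map, hortonStrahler]

/-- The left subtrees of the nodes on the right spine are empty or have Horton-Strahler number
below `v`. -/
def LightRight (v : ℕ) : BinaryTree α → Prop
  | .nil => True
  | .node _ l r => (l ≠ .nil → hortonStrahler l < v) ∧ LightRight v r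

/-- The right subtrees of the nodes on the left spine are empty or have Horton-Strahler number
below `v`. -/
def LightLeft (v : ℕ) : BinaryTree α → Prop
  | .nil => True
  | .node _ l r => (r ≠ .nil → hortonStrahler r < v) ∧ LightLeft v l

lemma map_eq_nil (f : α → β) (t : BinaryTree α) : t.map f = .nil ↔ t = .nil := by
  cases t <;> simp [BinaryTree.map]

lemma lightRight_map (f : α → β) (v : ℕ) (t : BinaryTree α) :
    LightRight v (t.map f) ↔ LightRight v t := by
  induction t with
  | nil => rfl
  | node a l r _ ihr => simp [BinaryTree.map, LightRight, ihr, hortonStrahler_map, map_eq_nil]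

lemma lightLeft_map (f : α → β) (v : ℕ) (t : BinaryTree α) :
    LightLeft v (t.map f) ↔ LightLeft v t := by
  induction t with
  | nil => rfl
  | node a l r ihl _ => simp [BinaryTree.map, LightLeft, ihl, hortonStrahler_map, map_eq_nil]

lemma LightRight.mono {v w : ℕ} (h : v ≤ w) {t : BinaryTree α} (ht : LightRight v t) :
    LightRight w t := by
  induction t with
  | nil => trivial
  | node a l r _ ihr => exact ⟨fun hl => (ht.1 hl).trans_le h, ihr ht.2⟩

lemma LightLeft.mono {v w : ℕ} (h : v ≤ w) {t : BinaryTree α} (ht : LightLeft v t) :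
    LightLeft w t := by
  induction t with
  | nil => trivial
  | node a l r ihl _ => exact ⟨fun hl => (ht.1 hl).trans_le h, ihl ht.2⟩

lemma graftRight_ne_nil (t : BinaryTree α) {s : BinaryTree α} (hs : s ≠ .nil) :
    graftRight t s ≠ .nil := by
  cases t <;> simp [graftRight, hs]

lemma graftLeft_ne_nil (t : BinaryTree α) {s : BinaryTree α} (hs : s ≠ .nil) :
    graftLeft t s ≠ .nil := by
  cases t <;> simp [graftLeft, hs]

/-- The guard `l ≠ .nil` is essential: the empty tree has conventional value 0, which is not below
the number 0 of a leaf. -/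
lemma hortonStrahler_node_of_left_lt (a : α) {l r : BinaryTree α} (hr : r ≠ .nil)
    (hl : l ≠ .nil → hortonStrahler l < hortonStrahler r) :
    hortonStrahler (.node a l r) = hortonStrahler r := by
  cases r with
  | nil => exact absurd rfl hr
  | node b r₁ r₂ =>
    cases l with
    | nil => rfl
    | node c l₁ l₂ =>
      have := hl (by simp)
      simp only [hortonStrahler]
      rw [if_neg this.ne, max_eq_right this.le, add_zero]

lemma hortonStrahler_node_of_right_lt (a : α) {l r : BinaryTree α} (hl : l ≠ .nil)
    (hr : r ≠ .nil → hortonStrahler r < hortonStrahler l) :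
    hortonStrahler (.node a l r) = hortonStrahler l := by
  cases l with
  | nil => exact absurd rfl hl
  | node b l₁ l₂ =>
    cases r with
    | nil => rfl
    | node c r₁ r₂ =>
      have := hr (by simp)
      simp only [hortonStrahler]
      rw [if_neg this.ne', max_eq_left this.le, add_zero]

lemma hortonStrahler_node_of_eq (a : α) {l r : BinaryTree α} (hl : l ≠ .nil) (hr : r ≠ .nil)
    (h : hortonStrahler l = hortonStrahler r) :
    hortonStrahler (.node a l r) = hortonStrahler l + 1 := by
  cases l with
  | nil => exact absurd rfl hl
  | node b l₁ l₂ =>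
    cases r with
    | nil => exact absurd rfl hr
    | node c r₁ r₂ => simp only [hortonStrahler]; rw [if_pos h, h, max_self]

/-- Climbing the right spine from `s`, each node meets only a smaller competitor on its left, so the
number of `s` reaches the root. -/
lemma hortonStrahler_graftRight {t s : BinaryTree α} (hs : s ≠ .nil)
    (ht : LightRight (hortonStrahler s) t) :
    hortonStrahler (graftRight t s) = hortonStrahler s := by
  induction t with
  | nil => rfl
  | node a l r _ ihr =>
    have := ihr ht.2
    rw [graftRight, hortonStrahler_node_of_left_lt a (graftRight_ne_nil r hs), this]
    rw [this]; exact ht.1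

lemma hortonStrahler_graftLeft {t s : BinaryTree α} (hs : s ≠ .nil)
    (ht : LightLeft (hortonStrahler s) t) :
    hortonStrahler (graftLeft t s) = hortonStrahler s := by
  induction t with
  | nil => rfl
  | node a l r ihl _ =>
    have := ihl ht.2
    rw [graftLeft, hortonStrahler_node_of_right_lt a (graftLeft_ne_nil l hs), this]
    rw [this]; exact ht.1

lemma LightRight.graftRight {v : ℕ} {t s : BinaryTree α} (ht : LightRight v t)
    (hs : LightRight v s) : LightRight v (graftRight t s) := by
  induction t with
  | nil => exact hs
  | node a l r _ ihr => exact ⟨ht.1, ihr ht.2⟩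

lemma LightLeft.graftLeft {v : ℕ} {t s : BinaryTree α} (ht : LightLeft v t)
    (hs : LightLeft v s) : LightLeft v (graftLeft t s) := by
  induction t with
  | nil => exact hs
  | node a l r ihl _ => exact ⟨ht.1, ihl ht.2⟩

/-- A nonempty tree with Horton-Strahler number `h` whose two spines are light. -/
def IsLight (h : ℕ) (t : BinaryTree α) : Prop :=
  t ≠ .nil ∧ hortonStrahler t = h ∧ LightRight h t ∧ LightLeft h t

/-- A tree with Horton-Strahler number `h` whose right spine is light, while its left spine has
its only heavy right subtree at the root. -/
def IsHeavyRight (h : ℕ) : BinaryTree α → Prop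
  | .nil => False
  | .node a l r => hortonStrahler (.node a l r) = h ∧ LightRight h (.node a l r) ∧
      LightLeft h l ∧ r ≠ .nil ∧ hortonStrahler r = h

/-- The mirror image of `IsHeavyRight`. -/
def IsHeavyLeft (h : ℕ) : BinaryTree α → Prop
  | .nil => False
  | .node a l r => hortonStrahler (.node a l r) = h ∧ LightLeft h (.node a l r) ∧
      LightRight h r ∧ l ≠ .nil ∧ hortonStrahler l = h

/-- Grafting on the right leaves `l` untouched and pushes the number `h` of `s` up to the root's
right child. Lightness of the left spine is needed only below the root, so this serves both light
and already right-heavy trees. -/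
lemma isHeavyRight_graftRight {h : ℕ} {a : α} {l r s : BinaryTree α}
    (h1 : LightRight h (.node a l r)) (h2 : LightLeft h l) (hs : s ≠ .nil)
    (hs' : hortonStrahler s = h) (hr : LightRight h s) :
    IsHeavyRight h (graftRight (.node a l r) s) := by
  subst hs'
  exact ⟨hortonStrahler_graftRight hs h1, h1.graftRight hr, h2, graftRight_ne_nil r hs,
    hortonStrahler_graftRight hs h1.2⟩

lemma isHeavyLeft_graftLeft {h : ℕ} {a : α} {l r s : BinaryTree α}
    (h1 : LightLeft h (.node a l r)) (h2 : LightRight h r) (hs : s ≠ .nil)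
    (hs' : hortonStrahler s = h) (hr : LightLeft h s) :
    IsHeavyLeft h (graftLeft (.node a l r) s) := by
  subst hs'
  exact ⟨hortonStrahler_graftLeft hs h1, h1.graftLeft hr, h2, graftLeft_ne_nil l hs,
    hortonStrahler_graftLeft hs h1.2⟩

section Doubling

variable {t : BinaryTree α} {h : ℕ} {f g : α → α}

lemma IsLight.isHeavyRight (ht : IsLight h t) :
    IsHeavyRight h (graftRight (t.map f) (t.map g)) := by
  obtain ⟨h0, h1, h2, h3⟩ := ht
  cases t with
  | nil => exact absurd rfl h0
  | node a l r =>
    apply isHeavyRight_graftRight ((lightRight_map f h (.node a l r)).2 h2)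
      ((lightLeft_map f h l).2 h3.2)
    · simp [BinaryTree.map]
    · rw [hortonStrahler_map, h1]
    · rwa [lightRight_map]

lemma IsLight.isHeavyLeft (ht : IsLight h t) :
    IsHeavyLeft h (graftLeft (t.map f) (t.map g)) := by
  obtain ⟨h0, h1, h2, h3⟩ := ht
  cases t with
  | nil => exact absurd rfl h0
  | node a l r =>
    apply isHeavyLeft_graftLeft ((lightLeft_map f h (.node a l r)).2 h3)
      ((lightRight_map f h r).2 h2.2)
    · simp [BinaryTree.map]
    · rw [hortonStrahler_map, h1]
    · rwa [lightLeft_map]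

lemma IsHeavyRight.graftRight (ht : IsHeavyRight h t) :
    IsHeavyRight h (graftRight (t.map f) (t.map g)) := by
  cases t with
  | nil => exact ht.elim
  | node a l r =>
    obtain ⟨h1, h2, h3, -⟩ := ht
    apply isHeavyRight_graftRight ((lightRight_map f h (.node a l r)).2 h2)
      ((lightLeft_map f h l).2 h3)
    · simp [BinaryTree.map]
    · rw [hortonStrahler_map, h1]
    · rwa [lightRight_map]

lemma IsHeavyLeft.graftLeft (ht : IsHeavyLeft h t) :
    IsHeavyLeft h (graftLeft (t.map f) (t.map g)) := by
  cases t with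
  | nil => exact ht.elim
  | node a l r =>
    obtain ⟨h1, h2, h3, -⟩ := ht
    apply isHeavyLeft_graftLeft ((lightLeft_map f h (.node a l r)).2 h2)
      ((lightRight_map f h r).2 h3)
    · simp [BinaryTree.map]
    · rw [hortonStrahler_map, h1]
    · rwa [lightLeft_map]

/-- The only step that raises the number: the root has a right child of number `h`, and the grafted
copy gives it a left child of number `h`. Every subtree hanging off a spine now has number at most
`h`, hence is light relative to `h + 1`. -/
lemma IsHeavyRight.isLight (ht : IsHeavyRight h t) :
    IsLight (h + 1) (graftLeft (t.map f) (t.map g)) := by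
  cases t with
  | nil => exact ht.elim
  | node a l r =>
    obtain ⟨h1, h2, h3, h4, h5⟩ := ht
    have e1 : hortonStrahler ((BinaryTree.node a l r).map g) = h := by rw [hortonStrahler_map, h1]
    have e2 : (BinaryTree.node a l r).map g ≠ .nil := by simp [BinaryTree.map]
    have e3 : hortonStrahler (Butterfly.graftLeft (l.map f) ((BinaryTree.node a l r).map g)) = h :=
      (hortonStrahler_graftLeft e2 (by rwa [e1, lightLeft_map])).trans e1
    have e4 : hortonStrahler (r.map f) = h := by rw [hortonStrahler_map, h5]
    have e5 : LightLeft (h + 1) (.node a l r) :=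
      ⟨fun _ => h5 ▸ Nat.lt_succ_self _, h3.mono h.le_succ⟩
    refine ⟨graftLeft_ne_nil _ e2, ?_, ⟨fun _ => ?_, ?_⟩, ⟨fun _ => ?_, ?_⟩⟩
    · rw [BinaryTree.map, Butterfly.graftLeft, hortonStrahler_node_of_eq _ (graftLeft_ne_nil _ e2)
        (by rwa [Ne, map_eq_nil]), e3]
      rw [e3, e4]
    · rw [e3]; exact h.lt_succ_self
    · exact ((lightRight_map f h r).2 h2.2).mono h.le_succ
    · rw [e4]; exact h.lt_succ_self
    · exact (((lightLeft_map f h l).2 h3).mono h.le_succ).graftLeft ((lightLeft_map g _ _).2 e5)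

lemma IsHeavyLeft.isLight (ht : IsHeavyLeft h t) :
    IsLight (h + 1) (graftRight (t.map f) (t.map g)) := by
  cases t with
  | nil => exact ht.elim
  | node a l r =>
    obtain ⟨h1, h2, h3, h4, h5⟩ := ht
    have e1 : hortonStrahler ((BinaryTree.node a l r).map g) = h := by rw [hortonStrahler_map, h1]
    have e2 : (BinaryTree.node a l r).map g ≠ .nil := by simp [BinaryTree.map]
    have e3 : hortonStrahler (Butterfly.graftRight (r.map f) ((BinaryTree.node a l r).map g)) = h :=
      (hortonStrahler_graftRight e2 (by rwa [e1, lightRight_map])).trans e1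
    have e4 : hortonStrahler (l.map f) = h := by rw [hortonStrahler_map, h5]
    have e5 : LightRight (h + 1) (.node a l r) :=
      ⟨fun _ => h5 ▸ Nat.lt_succ_self _, h3.mono h.le_succ⟩
    refine ⟨graftRight_ne_nil _ e2, ?_, ⟨fun _ => ?_, ?_⟩, ⟨fun _ => ?_, ?_⟩⟩
    · rw [BinaryTree.map, Butterfly.graftRight, hortonStrahler_node_of_eq _
        (by rwa [Ne, map_eq_nil]) (graftRight_ne_nil _ e2), e4]
      rw [e3, e4]
    · rw [e4]; exact h.lt_succ_self
    · exact (((lightRight_map f h r).2 h3).mono h.le_succ).graftRight ((lightRight_map g _ _).2 e5)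
    · rw [e3]; exact h.lt_succ_self
    · exact ((lightLeft_map f h l).2 h2.2).mono h.le_succ

end Doubling

/-! ### The automaton driven by the bits -/

/-- The state of the spines of the simple butterfly tree: `none` if both spines are light, and
otherwise the last bit. -/
abbrev State := Option Bool × ℕ

/-- Effect of a further bit on the state of the spines and on the Horton-Strahler number. -/
def step (s : State) (b : Bool) : State :=
  match s.1 with
  | none => (some b, s.2)
  | some c => if c = b then s else (none, s.2 + 1)

/-- The state reached with a bit string. -/
def state : (n : ℕ) → (Fin n → Bool) → State
  | 0, _ => (none, 0)
  | n + 1, x => step (state n (Fin.init x)) (x (Fin.last n))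

/-- The property of the tree that belongs to a state. -/
def HasState : State → BinaryTree α → Prop
  | (none, h), t => IsLight h t
  | (some false, h), t => IsHeavyRight h t
  | (some true, h), t => IsHeavyLeft h t

lemma HasState.hortonStrahler_eq {s : State} {t : BinaryTree α} (h : HasState s t) :
    hortonStrahler t = s.2 := by
  rcases s with ⟨_ | _ | _, k⟩
  · exact h.2.1
  · cases t with
    | nil => exact h.elim
    | node a l r => exact h.1
  · cases t with
    | nil => exact h.elim
    | node a l r => exact h.1

lemma hasState_step {s : State} {t : BinaryTree α} (h : HasState s t) (b : Bool) (f g : α → α) :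
    HasState (step s b)
      (if b then graftLeft (t.map f) (t.map g) else graftRight (t.map g) (t.map f)) := by
  rcases s with ⟨_ | _ | _, k⟩ <;> cases b <;> simp only [step, HasState] at h ⊢
  · exact h.isHeavyRight
  · exact h.isHeavyLeft
  · exact h.graftRight
  · exact h.isLight
  · exact h.isLight
  · exact h.graftLeft

lemma insertList_keys_succ (n : ℕ) (x : Fin (n + 1) → Bool) :
    insertList .nil (keys (n + 1) x) =
      if x (Fin.last n) then
        graftLeft ((insertList .nil (keys n (Fin.init x))).map (2 ^ n + ·))
          ((insertList .nil (keys n (Fin.init x))).map id)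
      else
        graftRight ((insertList .nil (keys n (Fin.init x))).map id)
          ((insertList .nil (keys n (Fin.init x))).map (2 ^ n + ·)) := by
  have hf : StrictMono (2 ^ n + · : ℕ → ℕ) := fun a b h => Nat.add_lt_add_left h _
  rw [keys_succ, BinaryTree.id_map, map_insertList hf]
  split_ifs
  · refine insertList_append_of_gt fun k hk j hj => ?_
    obtain ⟨i, -, rfl⟩ := List.mem_map.1 hj
    exact (lt_of_mem_keys hk).trans_le (Nat.le_add_right _ _)
  · refine insertList_append_of_lt fun k hk j hj => ?_
    obtain ⟨i, -, rfl⟩ := List.mem_map.1 hk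
    exact (lt_of_mem_keys hj).trans_le (Nat.le_add_right _ _)

lemma hasState_keys (n : ℕ) (x : Fin n → Bool) :
    HasState (state n x) (insertList .nil (keys n x)) := by
  induction n with
  | zero =>
    -- A single node has number 0, and its spines are light because nothing hangs off them.
    simp [keys, state, HasState, IsLight, bstInsert, hortonStrahler, LightRight, LightLeft]
  | succ n ih =>
    rw [insertList_keys_succ]
    exact hasState_step (ih _) _ _ _

lemma HS_eq_state (n : ℕ) (x : Fin n → Bool) : HS n x = ((state n x).2 : ℝ) := by
  rw [HS, ← hortonStrahler_map Fin.val, map_val_simpleTree, (hasState_keys n x).hortonStrahler_eq]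

/-! ### Averaging over uniform bits -/

/-- The mean of `G` at the Horton-Strahler number after `n` further bits, when the number is `h`
and both spines are light. -/
noncomputable def hsAvg (G : ℕ → ℝ) : ℕ → ℕ → ℝ
  | 0, h => G h
  | 1, h => G h
  | n + 2, h => (hsAvg G (n + 1) h + hsAvg G n (h + 1)) / 2

lemma sum_bits_succ {n : ℕ} (F : (Fin (n + 1) → Bool) → ℝ) :
    ∑ x, F x = ∑ y : Fin n → Bool,
      (F (Fin.snoc (α := fun _ => Bool) y false) + F (Fin.snoc (α := fun _ => Bool) y true)) := by
  rw [← (Fin.snocEquiv (fun _ => Bool)).sum_comp, Fintype.sum_prod_type, Fintype.sum_bool,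
    ← Finset.sum_add_distrib]
  exact Finset.sum_congr rfl fun y _ => add_comm _ _

/-- Averaging a function of the state over the next bit. -/
noncomputable def stepAvg (g : State → ℝ) (s : State) : ℝ :=
  (g (step s false) + g (step s true)) / 2

lemma sum_state_succ (n : ℕ) (g : State → ℝ) :
    ∑ x, g (state (n + 1) x) = 2 * ∑ x, stepAvg g (state n x) := by
  rw [sum_bits_succ, Finset.mul_sum]
  refine Finset.sum_congr rfl fun y _ => ?_
  simp only [state, Fin.init_snoc, Fin.snoc_last, stepAvg]
  ring

lemma sum_state (n : ℕ) (g : State → ℝ) :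
    ∑ x, g (state n x) = 2 ^ n * stepAvg^[n] g (none, 0) := by
  induction n generalizing g with
  | zero => simp [state]
  | succ n ih => rw [sum_state_succ, ih, Function.iterate_succ_apply, pow_succ]; ring

lemma stepAvg_some {g : State → ℝ} (hg : ∀ h, g (some false, h) = g (some true, h)) (b : Bool)
    (h : ℕ) : stepAvg g (some b, h) = (g (some true, h) + g (none, h + 1)) / 2 := by
  cases b <;> simp [stepAvg, step, hg, add_comm]

lemma stepAvg_none {g : State → ℝ} (hg : ∀ h, g (some false, h) = g (some true, h)) (h : ℕ) :
    stepAvg g (none, h) = g (some true, h) := by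
  simp [stepAvg, step, hg]

/-- Flipping all bits exchanges the two heavy states and preserves the number, so they need not be
distinguished in averages. -/
lemma iterate_stepAvg_symm (G : ℕ → ℝ) (n h : ℕ) :
    stepAvg^[n] (fun s => G s.2) (some false, h) = stepAvg^[n] (fun s => G s.2) (some true, h) := by
  induction n generalizing h with
  | zero => rfl
  | succ n ih => rw [Function.iterate_succ_apply', stepAvg_some ih, stepAvg_some ih]

/-- From a light tree the first bit only selects the heavy side. The second bit repeats it, which is
the situation of a light tree with `n + 1` bits left, or differs, leaving a light tree of number `h
+ 1` with `n` bits left. -/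
lemma iterate_stepAvg (G : ℕ → ℝ) (n h : ℕ) :
    stepAvg^[n] (fun s => G s.2) (none, h) = hsAvg G n h := by
  induction n using Nat.twoStepInduction generalizing h with
  | zero => rfl
  | one => simp [stepAvg, step, hsAvg]
  | more n ih1 ih2 =>
    have h1 := ih2 h
    rw [Function.iterate_succ_apply', stepAvg_none (iterate_stepAvg_symm G n)] at h1
    rw [Function.iterate_succ_apply', stepAvg_none (iterate_stepAvg_symm G (n + 1)),
      Function.iterate_succ_apply', stepAvg_some (iterate_stepAvg_symm G n), h1, ih1, hsAvg]

lemma integral_bits {n : ℕ} (F : (Fin n → Bool) → ℝ) :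
    ∫ x, F x ∂(bits n) = (∑ x, F x) / 2 ^ n := by
  rw [bits, PMF.integral_eq_sum]
  simp [PMF.uniformOfFintype_apply, div_eq_inv_mul, Finset.mul_sum]

lemma integral_HS (n : ℕ) (F : ℝ → ℝ) :
    ∫ x, F (HS n x) ∂(bits n) = hsAvg (fun k => F k) n 0 := by
  simp only [HS_eq_state]
  rw [integral_bits, sum_state n (fun s => F s.2), iterate_stepAvg (fun k => F k)]
  field_simp

/-! ### Exact mean and variance -/

lemma hsAvg_id (n h : ℕ) :
    hsAvg (fun k => (k : ℝ)) n h = h + n / 3 - 2 / 9 + 2 / 9 * (-1 / 2) ^ n := by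
  induction n using Nat.twoStepInduction generalizing h with
  | zero => simp [hsAvg]
  | one => simp [hsAvg]; ring
  | more n ih1 ih2 => rw [hsAvg, ih1, ih2]; push_cast; ring

lemma hsAvg_sq (n h : ℕ) :
    hsAvg (fun k => (k : ℝ) ^ 2) n h =
      h ^ 2 + 2 * h * (n / 3 - 2 / 9 + 2 / 9 * (-1 / 2) ^ n) +
        (n ^ 2 / 9 - 2 * n / 27 + 2 / 27 + (-2 / 27 + 8 * n / 27) * (-1 / 2) ^ n) := by
  induction n using Nat.twoStepInduction generalizing h with
  | zero => simp [hsAvg]; norm_num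
  | one => simp [hsAvg]; ring
  | more n ih1 ih2 => rw [hsAvg, ih1, ih2]; push_cast; ring

lemma mean_eq (n : ℕ) : mean n = n / 3 - 2 / 9 + 2 / 9 * (-1 / 2) ^ n := by
  rw [mean, integral_HS n (fun y => y), hsAvg_id]; simp

lemma variance_HS (n : ℕ) :
    variance (HS n) (bits n) = 2 * n / 27 + 2 / 81 + 2 / 81 * (-1 / 2) ^ n +
      4 / 27 * n * (-1 / 2) ^ n - 4 / 81 * ((-1 / 2) ^ n) ^ 2 := by
  have h1 : ∫ x, HS n x ^ 2 ∂(bits n) = _ := (integral_HS n (fun y => y ^ 2)).trans (hsAvg_sq n 0)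
  rw [variance_eq_sub MemLp.of_discrete]
  change ∫ x, HS n x ^ 2 ∂(bits n) - (mean n) ^ 2 = _
  rw [h1, mean_eq]
  simp only [CharP.cast_eq_zero]
  ring

lemma abs_neg_half_pow (n : ℕ) : |((-1 / 2 : ℝ)) ^ n| = (1 / 2) ^ n := by
  rw [abs_pow]; norm_num [abs_of_neg]

lemma nat_mul_half_pow_le (n : ℕ) : (n : ℝ) * (1 / 2) ^ n ≤ 1 / 2 := by
  induction n with
  | zero => norm_num
  | succ n ih =>
    rcases n with _ | n
    · norm_num
    · have : (0 : ℝ) ≤ (1 / 2) ^ (n + 1) := by positivity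
      rw [pow_succ]; push_cast at ih ⊢
      nlinarith [mul_nonneg (Nat.cast_nonneg (α := ℝ) n) this]

lemma abs_mean_sub_le (n : ℕ) : |mean n - n / 3| ≤ 1 := by
  have h := abs_neg_half_pow n
  have h1 : ((1 : ℝ) / 2) ^ n ≤ 1 := pow_le_one₀ (by norm_num) (by norm_num)
  rw [← h, abs_le] at h1
  rw [mean_eq, abs_le]
  constructor <;> linarith

lemma abs_variance_sub_le (n : ℕ) : |variance (HS n) (bits n) - 2 * n / 27| ≤ 1 := by
  have h := abs_neg_half_pow n
  have h1 : ((1 : ℝ) / 2) ^ n ≤ 1 := pow_le_one₀ (by norm_num) (by norm_num)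
  have h2 := nat_mul_half_pow_le n
  rw [← h] at h1 h2
  rw [← abs_of_nonneg (Nat.cast_nonneg (α := ℝ) n), ← abs_mul] at h2
  have h3 := sq_abs ((-1 / 2 : ℝ) ^ n)
  have h4 : |(-1 / 2 : ℝ) ^ n| ^ 2 ≤ 1 := pow_le_one₀ (abs_nonneg _) h1
  rw [abs_le] at h1 h2
  rw [variance_HS, abs_le]
  constructor <;> nlinarith [sq_nonneg ((-1 / 2 : ℝ) ^ n)]

/-- The bound on `n` is sharp: with at most one bit the number is always 0. -/
lemma variance_HS_pos {n : ℕ} (hn : 2 ≤ n) : 0 < variance (HS n) (bits n) := by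
  have h := abs_neg_half_pow n
  have h1 : ((1 : ℝ) / 2) ^ n ≤ 1 / 4 :=
    (pow_le_pow_of_le_one (by norm_num) (by norm_num) hn).trans (by norm_num)
  have h2 := nat_mul_half_pow_le n
  have hn' : (2 : ℝ) ≤ n := by exact_mod_cast hn
  rw [← h] at h1 h2
  rw [← abs_of_nonneg (Nat.cast_nonneg (α := ℝ) n), ← abs_mul] at h2
  have h3 := sq_abs ((-1 / 2 : ℝ) ^ n)
  have h4 : |(-1 / 2 : ℝ) ^ n| ^ 2 ≤ 1 := pow_le_one₀ (abs_nonneg _) (by linarith)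
  rw [abs_le] at h1 h2
  rw [variance_HS]
  nlinarith [sq_nonneg ((-1 / 2 : ℝ) ^ n)]

lemma sd_pos {n : ℕ} (hn : 2 ≤ n) : 0 < sd n := Real.sqrt_pos.2 (variance_HS_pos hn)

/-! ### Tail probabilities as binomial tails -/

/-- The mean of `f` at the position of the simple symmetric random walk after `m` steps. -/
noncomputable def walk : ℕ → (ℝ → ℝ) → ℝ
  | 0, f => f 0
  | m + 1, f => (walk m (fun s => f (s + 1)) + walk m (fun s => f (s - 1))) / 2

/-- The probability that the walk is at most `m - 2 * j` after `m` steps, i.e. that at least `j`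
of `m` fair coin tosses succeed. -/
noncomputable def walkTail (m j : ℕ) : ℝ := walk m (fun s => if s ≤ m - 2 * j then 1 else 0)

lemma walkTail_succ_succ (m j : ℕ) :
    walkTail (m + 1) (j + 1) = (walkTail m (j + 1) + walkTail m j) / 2 := by
  have h1 : ∀ s : ℝ, s + 1 ≤ (m + 1 : ℕ) - 2 * (j + 1 : ℕ) ↔ s ≤ m - 2 * (j + 1 : ℕ) := by
    intro s; push_cast; constructor <;> intro <;> linarith
  have h2 : ∀ s : ℝ, s - 1 ≤ (m + 1 : ℕ) - 2 * (j + 1 : ℕ) ↔ s ≤ m - 2 * j := by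
    intro s; push_cast; constructor <;> intro <;> linarith
  simp only [walkTail, walk, h1, h2]

lemma walkTail_zero_right (m : ℕ) : walkTail m 0 = 1 := by
  suffices ∀ z : ℝ, m ≤ z → walk m (fun s => if s ≤ z then 1 else 0) = 1 from
    this _ (by simp)
  induction m with
  | zero => intro z hz; simpa [walk] using hz
  | succ m ih =>
    intro z hz
    push_cast at hz
    simp only [walk, ← le_sub_iff_add_le, sub_le_iff_le_add]
    rw [ih _ (by linarith), ih _ (by linarith)]
    norm_num

lemma walkTail_zero_succ (j : ℕ) : walkTail 0 (j + 1) = 0 := by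
  have : ¬ (0 : ℝ) ≤ (0 : ℕ) - 2 * (j + 1 : ℕ) := by push_cast; linarith [j.cast_nonneg (α := ℝ)]
  simp only [walkTail, walk, if_neg this]

lemma walkTail_eq_zero {m j : ℕ} (h : m < j) : walkTail m j = 0 := by
  induction m generalizing j with
  | zero => obtain ⟨j, rfl⟩ := Nat.exists_eq_succ_of_ne_zero h.ne'; exact walkTail_zero_succ j
  | succ m ih =>
    obtain ⟨j, rfl⟩ := Nat.exists_eq_succ_of_ne_zero (Nat.ne_zero_of_lt h)
    rw [walkTail_succ_succ, ih (by omega), ih (by omega)]; simp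

lemma hsAvg_of_le {k : ℕ} (n : ℕ) {h : ℕ} (hk : k ≤ h) :
    hsAvg (fun i => if k ≤ i then 1 else 0) n h = 1 := by
  induction n using Nat.twoStepInduction generalizing h with
  | zero => simp [hsAvg, hk]
  | one => simp [hsAvg, hk]
  | more n ih1 ih2 => rw [hsAvg, ih1 (by omega), ih2 hk]; norm_num

lemma hsAvg_of_lt {k : ℕ} (n : ℕ) {h : ℕ} (hk : h + n < k) :
    hsAvg (fun i => if k ≤ i then 1 else 0) n h = 0 := by
  induction n using Nat.twoStepInduction generalizing h with
  | zero => simp [hsAvg]; omega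
  | one => simp [hsAvg]; omega
  | more n ih1 ih2 => rw [hsAvg, ih1 (by omega), ih2 (by omega)]; norm_num

/-- Each of the `j` missing increments spends one bit on choosing the heavy side; the other `m` bits
act as fair tosses, success being a change of bit. Formally, the recursion of `hsAvg` becomes
Pascal's rule `walkTail_succ_succ`. -/
lemma hsAvg_tail {k : ℕ} (n : ℕ) {h m j : ℕ} (hn : n = m + j) (hk : k = h + j) :
    hsAvg (fun i => if k ≤ i then 1 else 0) n h = walkTail m j := by
  induction n using Nat.twoStepInduction generalizing h m j with
  | zero =>
    obtain ⟨rfl, rfl⟩ : m = 0 ∧ j = 0 := by omega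
    rw [hsAvg_of_le _ (by omega), walkTail_zero_right]
  | one =>
    rcases j with _ | j
    · rw [hsAvg_of_le _ (by omega), walkTail_zero_right]
    · obtain ⟨rfl, rfl⟩ : m = 0 ∧ j = 0 := by omega
      rw [walkTail_zero_succ]; simp [hsAvg, hk]
  | more n ih1 ih2 =>
    rcases j with _ | j
    · rw [hsAvg_of_le _ (by omega), walkTail_zero_right]
    rcases m with _ | m
    · rw [walkTail_zero_succ, hsAvg, hsAvg_of_lt _ (by omega), hsAvg_of_lt _ (by omega)]; simp
    · rw [hsAvg, walkTail_succ_succ, ih2 (m := m) (j := j + 1) (by omega) hk,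
        ih1 (m := m) (j := j) (by omega) (by omega)]

lemma measureReal_le_HS (n k : ℕ) :
    (bits n).real {x | (k : ℝ) ≤ HS n x} = hsAvg (fun i => if k ≤ i then 1 else 0) n 0 := by
  classical
  have h := integral_HS n (fun y => if (k : ℝ) ≤ y then 1 else 0)
  simp only [Nat.cast_le] at h
  rw [← h, ← integral_indicator_one (MeasurableSet.of_discrete)]
  rfl

lemma measureReal_le_HS_eq_walkTail {n k : ℕ} (hk : k ≤ n) :
    (bits n).real {x | (k : ℝ) ≤ HS n x} = walkTail (n - k) k := by
  rw [measureReal_le_HS, hsAvg_tail n (m := n - k) (j := k) (by omega) (by omega)]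

lemma measureReal_le_HS_eq_zero {n k : ℕ} (hk : n < 2 * k) :
    (bits n).real {x | (k : ℝ) ≤ HS n x} = 0 := by
  by_cases h : k ≤ n
  · rw [measureReal_le_HS_eq_walkTail h, walkTail_eq_zero (by omega)]
  · rw [measureReal_le_HS, hsAvg_of_lt n (by omega)]

/-! ### Moments and concentration of the simple random walk -/

lemma walk_mono (m : ℕ) {f g : ℝ → ℝ} (h : ∀ s, f s ≤ g s) : walk m f ≤ walk m g := by
  induction m generalizing f g with
  | zero => exact h 0
  | succ m ih =>
    have h1 := ih (fun s => h (s + 1))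
    have h2 := ih (fun s => h (s - 1))
    simp only [walk]; linarith

lemma walk_add (m : ℕ) (f g : ℝ → ℝ) : walk m (fun s => f s + g s) = walk m f + walk m g := by
  induction m generalizing f g with
  | zero => rfl
  | succ m ih => simp only [walk, ih]; ring

lemma walk_const_mul (m : ℕ) (c : ℝ) (f : ℝ → ℝ) :
    walk m (fun s => c * f s) = c * walk m f := by
  induction m generalizing f with
  | zero => rfl
  | succ m ih => simp only [walk, ih]; ring

lemma walk_const (m : ℕ) (c : ℝ) : walk m (fun _ => c) = c := by
  induction m with
  | zero => rfl
  | succ m ih => simp only [walk, ih]; ring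

lemma walk_sub (m : ℕ) (f g : ℝ → ℝ) : walk m (fun s => f s - g s) = walk m f - walk m g := by
  have := walk_add m (fun s => f s - g s) g
  simp only [sub_add_cancel] at this
  linarith

lemma abs_walk_le (m : ℕ) {f g : ℝ → ℝ} (h : ∀ s, |f s| ≤ g s) : |walk m f| ≤ walk m g := by
  rw [abs_le]
  refine ⟨?_, walk_mono m fun s => (abs_le.1 (h s)).2⟩
  have := walk_mono m (f := fun s => (-1) * g s) (g := f) fun s => by linarith [(abs_le.1 (h s)).1]
  rw [walk_const_mul] at this
  linarith

/-- Integration by parts for the simple random walk. -/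
lemma walk_succ_mul (m : ℕ) (f : ℝ → ℝ) :
    walk (m + 1) (fun s => s * f s) = (m + 1) * walk m (fun s => (f (s + 1) - f (s - 1)) / 2) := by
  induction m generalizing f with
  | zero => simp [walk]; ring
  | succ m ih =>
    have h : walk (m + 2) (fun s => s * f s) =
        walk (m + 1) (fun s => s * ((f (s + 1) + f (s - 1)) / 2)) +
          walk (m + 1) (fun s => (f (s + 1) - f (s - 1)) / 2) := by
      rw [← walk_add, walk, ← walk_add, div_eq_inv_mul, ← walk_const_mul]
      congr 1; funext s; ring
    rw [h, ih]
    have h2 : walk (m + 1) (fun s => (f (s + 1) - f (s - 1)) / 2) =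
        walk m (fun s => ((f (s + 1 + 1) + f (s + 1 - 1)) / 2 -
          (f (s - 1 + 1) + f (s - 1 - 1)) / 2) / 2) := by
      rw [walk, ← walk_add, div_eq_inv_mul, ← walk_const_mul]
      congr 1; funext s; simp only [add_sub_cancel_right, sub_add_cancel]; ring
    rw [h2]; push_cast; ring

lemma walk_sq (m : ℕ) : walk m (fun s => s ^ 2) = m := by
  cases m with
  | zero => simp [walk]
  | succ m =>
    have := walk_succ_mul m (fun s => s)
    simp only [← pow_two] at this
    rw [this]
    simp [walk_const]

lemma walk_abs_le (m : ℕ) : walk m (fun s => |s|) ≤ √m := by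
  rcases Nat.eq_zero_or_pos m with rfl | hm
  · simp [walk]
  have h : 0 < √(m : ℝ) := Real.sqrt_pos.2 (by exact_mod_cast hm)
  -- AM–GM, with weights balanced for the second moment `m`.
  have h1 : ∀ s : ℝ, |s| ≤ (2 * √(m : ℝ))⁻¹ * s ^ 2 + √m / 2 := by
    intro s
    have : (2 * √(m : ℝ))⁻¹ * s ^ 2 + √m / 2 - |s| = (2 * √(m : ℝ))⁻¹ * (|s| - √m) ^ 2 := by
      rw [sub_sq, sq_abs]; field_simp
      rw [Real.sq_sqrt m.cast_nonneg]; ring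
    have h2 : 0 ≤ (2 * √(m : ℝ))⁻¹ * (|s| - √m) ^ 2 := by positivity
    linarith
  refine (walk_mono m h1).trans (le_of_eq ?_)
  rw [walk_add, walk_const_mul, walk_sq, walk_const]
  nth_rewrite 2 [← Real.mul_self_sqrt (Nat.cast_nonneg (α := ℝ) m)]
  field_simp
  norm_num

/-- The walk is near a given point with probability of order `m ^ (-1/2)`. -/
lemma walk_near_le (m : ℕ) (y : ℝ) :
    walk m (fun s => if |s - y| ≤ 1 then 1 else 0) ≤ 2 / √(m + 1) := by
  -- The clamp has slope one within distance 2 of `y`, so its symmetric difference dominates the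
  -- indicator, while integration by parts bounds the mean of that difference by 2 E|S| / (m + 1).
  set f : ℝ → ℝ := fun s => max (-2) (min 2 (s - y)) with hf
  have hmono : Monotone f := fun a b h => max_le_max le_rfl (min_le_min le_rfl (by linarith))
  have hb : ∀ s, |f s| ≤ 2 := fun s =>
    abs_le.2 ⟨le_max_left _ _, max_le (by norm_num) (min_le_left _ _)⟩
  have h1 : ∀ s, (if |s - y| ≤ 1 then (1 : ℝ) else 0) ≤ (f (s + 1) - f (s - 1)) / 2 := by
    intro s
    split_ifs with h
    · obtain ⟨h2, h3⟩ := abs_le.1 h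
      simp only [hf]
      rw [min_eq_right (by linarith), min_eq_right (by linarith), max_eq_right (by linarith),
        max_eq_right (by linarith)]
      linarith
    · linarith [hmono (show s - 1 ≤ s + 1 by linarith)]
  have h2 : walk (m + 1) (fun s => s * f s) ≤ 2 * √(m + 1) := by
    have : walk (m + 1) (fun s => s * f s) ≤ walk (m + 1) (fun s => 2 * |s|) := by
      refine walk_mono _ fun s => (le_abs_self _).trans ?_
      rw [abs_mul]; nlinarith [abs_nonneg s, hb s]
    refine this.trans ?_
    rw [walk_const_mul]
    have := walk_abs_le (m + 1)
    push_cast at this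
    linarith
  rw [walk_succ_mul] at h2
  refine (walk_mono m h1).trans ?_
  have h3 : 0 < √((m : ℝ) + 1) := Real.sqrt_pos.2 (by positivity)
  rw [le_div_iff₀ h3]
  have h4 : √((m : ℝ) + 1) * √(m + 1) = m + 1 := Real.mul_self_sqrt (by positivity)
  refine le_of_mul_le_mul_right ?_ h3
  rw [mul_assoc, h4, mul_comm]
  exact h2

/-! ### Estimates for the normal law -/

/-- The standard normal density. -/
noncomputable def gaussDensity (x : ℝ) : ℝ := gaussianPDFReal 0 1 x

/-- The standard normal distribution function. -/
noncomputable def gaussCdf (x : ℝ) : ℝ := cdf (gaussianReal 0 1) x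

lemma gaussDensity_eq (x : ℝ) : gaussDensity x = (√(2 * Real.pi))⁻¹ * Real.exp (-x ^ 2 / 2) := by
  simp [gaussDensity, gaussianPDFReal]

lemma gaussDensity_pos (x : ℝ) : 0 < gaussDensity x := gaussianPDFReal_pos _ _ _ one_ne_zero

lemma gaussDensity_neg (x : ℝ) : gaussDensity (-x) = gaussDensity x := by
  simp [gaussDensity_eq]

lemma hasDerivAt_gaussDensity (x : ℝ) : HasDerivAt gaussDensity (-x * gaussDensity x) x := by
  have h : HasDerivAt (fun x : ℝ => (√(2 * Real.pi))⁻¹ * Real.exp (-x ^ 2 / 2))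
      ((√(2 * Real.pi))⁻¹ * (Real.exp (-x ^ 2 / 2) * (-(2 * x) / 2))) x := by
    have := (((hasDerivAt_pow 2 x).neg.div_const 2).exp).const_mul (√(2 * Real.pi))⁻¹
    simpa using this
  rw [show gaussDensity = fun x : ℝ => (√(2 * Real.pi))⁻¹ * Real.exp (-x ^ 2 / 2) from
    funext gaussDensity_eq]
  convert h using 1
  ring

lemma continuous_gaussDensity : Continuous gaussDensity :=
  continuous_iff_continuousAt.2 fun x => (hasDerivAt_gaussDensity x).continuousAt

lemma integrable_gaussDensity : Integrable gaussDensity := integrable_gaussianPDFReal 0 1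

lemma gaussCdf_eq_integral (x : ℝ) : gaussCdf x = ∫ t in Set.Iic x, gaussDensity t := by
  rw [gaussCdf, cdf_eq_real, measureReal_def, gaussianReal_apply_eq_integral _ one_ne_zero,
    ENNReal.toReal_ofReal]
  · rfl
  · exact integral_nonneg fun t => (gaussDensity_pos t).le

lemma hasDerivAt_gaussCdf (x : ℝ) : HasDerivAt gaussCdf (gaussDensity x) x := by
  have h : ∀ y, gaussCdf y = gaussCdf 0 + ∫ t in (0 : ℝ)..y, gaussDensity t := by
    intro y
    rw [← intervalIntegral.integral_Iic_sub_Iic integrable_gaussDensity.integrableOn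
      integrable_gaussDensity.integrableOn, gaussCdf_eq_integral, gaussCdf_eq_integral]
    ring
  rw [show gaussCdf = _ from funext h]
  exact (intervalIntegral.integral_hasDerivAt_right
    (continuous_gaussDensity.intervalIntegrable _ _)
    continuous_gaussDensity.stronglyMeasurable.stronglyMeasurableAtFilter
    continuous_gaussDensity.continuousAt).const_add _

lemma gaussCdf_nonneg (x : ℝ) : 0 ≤ gaussCdf x := cdf_nonneg _ _

lemma gaussCdf_le_one (x : ℝ) : gaussCdf x ≤ 1 := cdf_le_one _ _

lemma gaussCdf_mono : Monotone gaussCdf := monotone_cdf _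

lemma gaussCdf_neg (x : ℝ) : gaussCdf (-x) = 1 - gaussCdf x := by
  have h1 : ∫ t in Set.Ioi x, gaussDensity t = gaussCdf (-x) := by
    rw [gaussCdf_eq_integral, ← integral_comp_neg_Ioi]
    simp [gaussDensity_neg]
  have h2 : (∫ t in Set.Iic x, gaussDensity t) + ∫ t in Set.Ioi x, gaussDensity t = 1 := by
    rw [intervalIntegral.integral_Iic_add_Ioi integrable_gaussDensity.integrableOn
      integrable_gaussDensity.integrableOn]
    exact integral_gaussianPDFReal_eq_one 0 one_ne_zero
  rw [h1, ← gaussCdf_eq_integral] at h2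
  linarith

lemma tendsto_gaussDensity_atBot : Tendsto gaussDensity atBot (nhds 0) := by
  rw [show gaussDensity = _ from funext gaussDensity_eq, ← mul_zero (√(2 * Real.pi))⁻¹]
  refine Tendsto.const_mul _ (Real.tendsto_exp_atBot.comp ?_)
  have : Tendsto (fun x : ℝ => x ^ 2) atBot atTop := by
    simpa [Function.comp_def] using
      (tendsto_pow_atTop (α := ℝ) two_ne_zero).comp tendsto_neg_atBot_atTop
  refine (tendsto_neg_atTop_atBot.comp this).atBot_div_const (by norm_num)

lemma integrableOn_neg_mul_gaussDensity (w : ℝ) :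
    IntegrableOn (fun t => -t * gaussDensity t) (Set.Iic w) := by
  have h := (integrable_mul_exp_neg_mul_sq (b := 1 / 2) (by norm_num)).const_mul
    (-(√(2 * Real.pi))⁻¹)
  refine (h.congr (ae_of_all _ fun t => ?_)).integrableOn
  simp only [gaussDensity_eq]
  rw [show -(1 / 2) * t ^ 2 = -t ^ 2 / 2 by ring]; ring

/-- The Mills ratio bound. -/
lemma neg_mul_gaussCdf_le (w : ℝ) : -w * gaussCdf w ≤ gaussDensity w := by
  have h := integral_Iic_of_hasDerivAt_of_tendsto' (a := w)
    (fun x _ => hasDerivAt_gaussDensity x) (integrableOn_neg_mul_gaussDensity w)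
    tendsto_gaussDensity_atBot
  rw [sub_zero] at h
  rw [← h, gaussCdf_eq_integral, ← integral_const_mul]
  refine setIntegral_mono_on (integrable_gaussDensity.integrableOn.const_mul _)
    (integrableOn_neg_mul_gaussDensity w) measurableSet_Iic fun t ht => ?_
  exact mul_le_mul_of_nonneg_right (neg_le_neg ht) (gaussDensity_pos t).le

lemma mul_one_sub_gaussCdf_le (w : ℝ) : w * (1 - gaussCdf w) ≤ gaussDensity w := by
  have := neg_mul_gaussCdf_le (-w)
  rwa [gaussCdf_neg, gaussDensity_neg, neg_neg] at this

lemma gaussDensity_le_exp (x : ℝ) : gaussDensity x ≤ Real.exp (-x ^ 2 / 2) := by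
  rw [gaussDensity_eq]
  refine mul_le_of_le_one_left (Real.exp_pos _).le (inv_le_one_of_one_le₀ ?_)
  rw [Real.one_le_sqrt]
  linarith [Real.pi_gt_three]

lemma gaussDensity_le_one (x : ℝ) : gaussDensity x ≤ 1 :=
  (gaussDensity_le_exp x).trans (Real.exp_le_one_iff.2 (by nlinarith [sq_nonneg x]))

lemma one_le_mul_gaussDensity {x : ℝ} (hx : |x| ≤ 1) : 1 ≤ 6 * gaussDensity x := by
  have h1 : √(2 * Real.pi) ≤ 3 := by
    rw [Real.sqrt_le_left (by norm_num)]; linarith [Real.pi_lt_d2]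
  have h2 : 0 < √(2 * Real.pi) := Real.sqrt_pos.2 (by positivity)
  have h3 : (1 : ℝ) / 2 ≤ Real.exp (-x ^ 2 / 2) := by
    have := Real.add_one_le_exp (-x ^ 2 / 2)
    have h4 : x ^ 2 ≤ 1 := (sq_le_one_iff_abs_le_one x).2 hx
    linarith
  rw [gaussDensity_eq, ← mul_assoc, ← div_eq_mul_inv]
  have h5 : 2 ≤ 6 / √(2 * Real.pi) := by rw [le_div_iff₀ h2]; linarith
  nlinarith

lemma gaussCdf_le_of_nonpos {w : ℝ} (hw : w ≤ 0) : gaussCdf w ≤ 6 * gaussDensity w := by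
  rcases le_total (-1) w with h | h
  · exact (gaussCdf_le_one w).trans (one_le_mul_gaussDensity (abs_le.2 ⟨h, by linarith⟩))
  · nlinarith [neg_mul_gaussCdf_le w, gaussCdf_nonneg w, gaussDensity_pos w]

lemma one_sub_gaussCdf_le_of_nonneg {w : ℝ} (hw : 0 ≤ w) :
    1 - gaussCdf w ≤ 6 * gaussDensity w := by
  have := gaussCdf_le_of_nonpos (neg_nonpos.2 hw)
  rwa [gaussCdf_neg, gaussDensity_neg] at this

/-! ### Stein's equation for a half line -/

/-- The solution of Stein's equation to the left of the jump. -/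
noncomputable def steinLeft (z w : ℝ) : ℝ := gaussCdf w * (1 - gaussCdf z) / gaussDensity w

/-- The solution of Stein's equation to the right of the jump. -/
noncomputable def steinRight (z w : ℝ) : ℝ := gaussCdf z * (1 - gaussCdf w) / gaussDensity w

/-- The bounded solution of Stein's equation for the indicator of a half line. -/
noncomputable def stein (z w : ℝ) : ℝ := if w ≤ z then steinLeft z w else steinRight z w

lemma stein_of_le {z w : ℝ} (h : w ≤ z) : stein z w = steinLeft z w := if_pos h

lemma stein_of_ge {z w : ℝ} (h : z ≤ w) : stein z w = steinRight z w := by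
  rcases h.eq_or_lt with rfl | h
  · rw [stein_of_le le_rfl]; rfl
  · exact if_neg h.not_ge

lemma hasDerivAt_steinLeft (z w : ℝ) :
    HasDerivAt (steinLeft z) (w * steinLeft z w + (1 - gaussCdf z)) w := by
  have h := ((hasDerivAt_gaussCdf w).mul_const (1 - gaussCdf z)).div
    (hasDerivAt_gaussDensity w) (gaussDensity_pos w).ne'
  refine h.congr_deriv ?_
  have := (gaussDensity_pos w).ne'
  simp only [steinLeft]
  field_simp
  ring

lemma hasDerivAt_steinRight (z w : ℝ) :
    HasDerivAt (steinRight z) (w * steinRight z w - gaussCdf z) w := by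
  have h := (((hasDerivAt_gaussCdf w).const_sub 1).const_mul (gaussCdf z)).div
    (hasDerivAt_gaussDensity w) (gaussDensity_pos w).ne'
  refine h.congr_deriv ?_
  have := (gaussDensity_pos w).ne'
  simp only [steinRight]
  field_simp
  ring

lemma stein_nonneg (z w : ℝ) : 0 ≤ stein z w := by
  have h1 := gaussCdf_nonneg
  have h2 := fun x => sub_nonneg.2 (gaussCdf_le_one x)
  rw [stein]
  split_ifs
  · exact div_nonneg (mul_nonneg (h1 _) (h2 _)) (gaussDensity_pos w).le
  · exact div_nonneg (mul_nonneg (h1 _) (h2 _)) (gaussDensity_pos w).le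

/-- Monotonicity of the distribution function makes `z = w` the worst case, so the bounds below are
uniform in `z`. -/
lemma stein_le (z w : ℝ) : stein z w ≤ gaussCdf w * (1 - gaussCdf w) / gaussDensity w := by
  have h1 := gaussCdf_nonneg
  have h2 := fun x => sub_nonneg.2 (gaussCdf_le_one x)
  rw [stein]
  split_ifs with h
  · refine div_le_div_of_nonneg_right ?_ (gaussDensity_pos w).le
    exact mul_le_mul_of_nonneg_left (by linarith [gaussCdf_mono h]) (h1 w)
  · refine div_le_div_of_nonneg_right ?_ (gaussDensity_pos w).le
    exact mul_le_mul_of_nonneg_right (gaussCdf_mono (le_of_not_ge h)) (h2 w)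

lemma abs_stein_le (z w : ℝ) : |stein z w| ≤ 6 := by
  rw [abs_of_nonneg (stein_nonneg z w)]
  refine (stein_le z w).trans ((div_le_iff₀ (gaussDensity_pos w)).2 ?_)
  have h1 := gaussCdf_nonneg w
  have h2 := gaussCdf_le_one w
  rcases le_total w 0 with h | h
  · nlinarith [gaussCdf_le_of_nonpos h]
  · nlinarith [one_sub_gaussCdf_le_of_nonneg h]

lemma abs_mul_stein_le (z w : ℝ) : |w * stein z w| ≤ 1 := by
  rw [abs_mul, abs_of_nonneg (stein_nonneg z w)]
  refine (mul_le_mul_of_nonneg_left (stein_le z w) (abs_nonneg w)).trans ?_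
  rw [← mul_div_assoc, div_le_one (gaussDensity_pos w)]
  have h1 := gaussCdf_nonneg w
  have h2 := gaussCdf_le_one w
  rcases le_total w 0 with h | h
  · rw [abs_of_nonpos h, ← mul_assoc]
    refine (mul_le_of_le_one_right (mul_nonneg (neg_nonneg.2 h) h1) (by linarith)).trans
      (neg_mul_gaussCdf_le w)
  · rw [abs_of_nonneg h, mul_left_comm]
    exact (mul_le_of_le_one_left (mul_nonneg h (by linarith)) h2).trans
      (mul_one_sub_gaussCdf_le w)

/-- The derivative of the solution of Stein's equation. -/
noncomputable def steinDeriv (z w : ℝ) : ℝ :=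
  w * stein z w + ((if w ≤ z then 1 else 0) - gaussCdf z)

lemma steinDeriv_of_le {z w : ℝ} (h : w ≤ z) :
    steinDeriv z w = w * steinLeft z w + (1 - gaussCdf z) := by
  rw [steinDeriv, if_pos h, stein_of_le h]

lemma steinDeriv_of_gt {z w : ℝ} (h : z < w) :
    steinDeriv z w = w * steinRight z w - gaussCdf z := by
  rw [steinDeriv, if_neg h.not_ge, stein_of_ge h.le]; ring

lemma abs_steinDeriv_le (z w : ℝ) : |steinDeriv z w| ≤ 2 := by
  have h : |(if w ≤ z then (1 : ℝ) else 0) - gaussCdf z| ≤ 1 := by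
    have h1 := gaussCdf_nonneg z
    have h2 := gaussCdf_le_one z
    rw [abs_le]
    split_ifs <;> constructor <;> linarith
  exact (abs_add_le _ _).trans (by linarith [abs_mul_stein_le z w])

lemma hasDerivAt_stein {z w : ℝ} (h : w ≠ z) : HasDerivAt (stein z) (steinDeriv z w) w := by
  rcases h.lt_or_gt with h | h
  · rw [steinDeriv_of_le h.le]
    refine (hasDerivAt_steinLeft z w).congr_of_eventuallyEq ?_
    filter_upwards [eventually_lt_nhds h] with u hu using stein_of_le hu.le
  · rw [steinDeriv_of_gt h]
    refine (hasDerivAt_steinRight z w).congr_of_eventuallyEq ?_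
    filter_upwards [eventually_gt_nhds h] with u hu using stein_of_ge hu.le

lemma continuous_stein (z : ℝ) : Continuous (stein z) := by
  have h1 : Continuous (steinLeft z) :=
    continuous_iff_continuousAt.2 fun w => (hasDerivAt_steinLeft z w).continuousAt
  have h2 : Continuous (steinRight z) :=
    continuous_iff_continuousAt.2 fun w => (hasDerivAt_steinRight z w).continuousAt
  refine Continuous.if_le h1 h2 continuous_id continuous_const fun w hw => ?_
  rw [show z = w from hw.symm]; rfl

lemma exists_stein_sub_eq {z a b : ℝ} (hab : a < b) (hz : z ≤ a ∨ b ≤ z) :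
    ∃ c ∈ Set.Ioo a b, stein z b - stein z a = (b - a) * steinDeriv z c := by
  obtain ⟨c, hc, h⟩ := exists_hasDerivAt_eq_slope (stein z) (steinDeriv z) hab
    (continuous_stein z).continuousOn fun w hw => hasDerivAt_stein (by
      rintro rfl
      rcases hz with hz | hz
      · exact absurd hw.1 hz.not_gt
      · exact absurd hw.2 hz.not_gt)
  refine ⟨c, hc, ?_⟩
  rw [h]
  field_simp [(sub_pos.2 hab).ne']

lemma abs_stein_sub_le (z : ℝ) {a b : ℝ} (hab : a ≤ b) :
    |stein z b - stein z a| ≤ 2 * (b - a) := by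
  have key : ∀ {a b : ℝ}, a ≤ b → (z ≤ a ∨ b ≤ z) → |stein z b - stein z a| ≤ 2 * (b - a) := by
    intro a b hab hz
    rcases hab.eq_or_lt with rfl | hab
    · simp
    obtain ⟨c, -, h⟩ := exists_stein_sub_eq hab hz
    rw [h, abs_mul, abs_of_pos (sub_pos.2 hab), mul_comm]
    exact mul_le_mul_of_nonneg_right (abs_steinDeriv_le z c) (sub_pos.2 hab).le
  rcases le_total z a with h | h
  · exact key hab (Or.inl h)
  rcases le_total b z with h' | h'
  · exact key hab (Or.inr h')
  -- The solution has a kink at `z`, so the mean value theorem is applied on each side of it.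
  have := abs_sub_le (stein z b) (stein z z) (stein z a)
  linarith [key h (Or.inr le_rfl), key h' (Or.inl le_rfl)]

lemma abs_mul_stein_sub_le (z a c : ℝ) :
    |c * stein z c - a * stein z a| ≤ (2 * |c| + 6) * |c - a| := by
  have h : |stein z c - stein z a| ≤ 2 * |c - a| := by
    rcases le_total a c with h | h
    · rw [abs_of_nonneg (sub_nonneg.2 h)]; exact abs_stein_sub_le z h
    · rw [abs_sub_comm, abs_sub_comm c, abs_of_nonneg (sub_nonneg.2 h)]
      exact abs_stein_sub_le z h
  have e : c * stein z c - a * stein z a =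
      c * (stein z c - stein z a) + (c - a) * stein z a := by ring
  rw [e]
  refine (abs_add_le _ _).trans ?_
  rw [abs_mul, abs_mul]
  nlinarith [abs_nonneg c, abs_nonneg (c - a), abs_stein_le z a]

/-- The error of the trapezoidal rule for the derivative of the solution of Stein's equation. -/
lemma abs_steinDeriv_sub_slope_le {z a b : ℝ} (hab : a < b) :
    |(steinDeriv z b + steinDeriv z a) / 2 - (stein z b - stein z a) / (b - a)| ≤
      (2 * max |a| |b| + 6) * (b - a) + if a ≤ z ∧ z ≤ b then 4 else 0 := by
  have hpos : 0 < b - a := sub_pos.2 hab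
  have hmax : 0 ≤ max |a| |b| := (abs_nonneg a).trans (le_max_left _ _)
  split_ifs with h
  · have h1 : |(stein z b - stein z a) / (b - a)| ≤ 2 := by
      rw [abs_div, abs_of_pos hpos, div_le_iff₀ hpos]; exact abs_stein_sub_le z hab.le
    have h2 := abs_steinDeriv_le z a
    have h3 := abs_steinDeriv_le z b
    have h4 : 0 ≤ (2 * max |a| |b| + 6) * (b - a) := by positivity
    rw [abs_le] at h1 h2 h3 ⊢
    constructor <;> linarith
  -- Away from the jump, `steinDeriv` differs from `w * stein z w` by a constant and is therefore
  -- locally Lipschitz.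
  · have hz : z < a ∨ b < z := by
      rw [not_and_or, not_le, not_le] at h; exact h
    obtain ⟨c, hc, e⟩ := exists_stein_sub_eq hab (hz.imp le_of_lt le_of_lt)
    have key : ∀ u ∈ Set.Icc a b,
        |steinDeriv z c - steinDeriv z u| ≤ (2 * max |a| |b| + 6) * (b - a) := by
      intro u hu
      have e1 : steinDeriv z c - steinDeriv z u = c * stein z c - u * stein z u := by
        rcases hz with hz | hz
        · rw [steinDeriv, steinDeriv, if_neg (hz.trans hc.1).not_ge,
            if_neg (hz.trans_le hu.1).not_ge]; ring
        · rw [steinDeriv, steinDeriv, if_pos (hc.2.trans hz).le,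
            if_pos (hu.2.trans hz.le)]; ring
      rw [e1]
      refine (abs_mul_stein_sub_le z u c).trans ?_
      refine mul_le_mul ?_ ?_ (abs_nonneg _) (by positivity)
      · linarith [abs_le_max_abs_abs hc.1.le hc.2.le]
      · rw [abs_le]; constructor <;> linarith [hu.1, hu.2, hc.1, hc.2]
    rw [e, mul_div_cancel_left₀ _ hpos.ne', add_zero]
    have h1 := key a ⟨le_rfl, hab.le⟩
    have h2 := key b ⟨hab.le, le_rfl⟩
    rw [abs_le] at h1 h2 ⊢
    constructor <;> linarith

/-- The Berry-Esseen theorem for the simple symmetric random walk. -/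
theorem abs_walk_sub_gaussCdf_le (m : ℕ) (z : ℝ) :
    |walk (m + 1) (fun s => if s / √(m + 1) ≤ z then 1 else 0) - gaussCdf z| ≤
      36 / √(m + 1) := by
  set r : ℝ := √(m + 1) with hr
  have hr1 : 1 ≤ r := Real.one_le_sqrt.2 (by simp)
  have hr0 : 0 < r := by linarith
  have hrr : r * r = m + 1 := Real.mul_self_sqrt (by positivity)
  have e1 : walk (m + 1) (fun s => if s / r ≤ z then 1 else 0) - gaussCdf z =
      walk (m + 1) (fun s => steinDeriv z (s / r)) -
        walk (m + 1) (fun s => s / r * stein z (s / r)) := by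
    rw [← walk_sub]
    nth_rewrite 1 [← walk_const (m + 1) (gaussCdf z)]
    rw [← walk_sub]
    congr 1; funext s; simp only [steinDeriv]; ring
  -- Integration by parts, with `r * r = m + 1`, yields the difference quotient over the step `2 /
  -- r`; averaging `steinDeriv` over one step of the walk yields the matching trapezoidal mean.
  have e2 : walk (m + 1) (fun s => s / r * stein z (s / r)) =
      walk m (fun s => (stein z ((s + 1) / r) - stein z ((s - 1) / r)) /
        ((s + 1) / r - (s - 1) / r)) := by
    have h1 : ∀ s : ℝ, s / r * stein z (s / r) = s * (r⁻¹ * stein z (s / r)) := fun s => by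
      field_simp
    simp only [h1]
    rw [walk_succ_mul, ← hrr, ← walk_const_mul]
    congr 1; funext s; field_simp; ring
  have e3 : walk (m + 1) (fun s => steinDeriv z (s / r)) =
      walk m (fun s => (steinDeriv z ((s + 1) / r) + steinDeriv z ((s - 1) / r)) / 2) := by
    rw [walk, ← walk_add, div_eq_inv_mul, ← walk_const_mul]
    congr 1; funext s; ring
  rw [e1, e2, e3, ← walk_sub]
  have hbound : ∀ s : ℝ,
      |(steinDeriv z ((s + 1) / r) + steinDeriv z ((s - 1) / r)) / 2 -
        (stein z ((s + 1) / r) - stein z ((s - 1) / r)) / ((s + 1) / r - (s - 1) / r)| ≤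
      (4 / (r * r) * |s| + 16 / r) + 4 * if |s - z * r| ≤ 1 then 1 else 0 := by
    intro s
    have hlt : (s - 1) / r < (s + 1) / r := by gcongr; linarith
    refine (abs_steinDeriv_sub_slope_le hlt).trans (add_le_add ?_ (le_of_eq ?_))
    · have h1 : (s + 1) / r - (s - 1) / r = 2 / r := by ring
      have h2 : max |(s - 1) / r| |(s + 1) / r| ≤ |s| / r + 1 := by
        have h3 : 1 / r ≤ 1 := by rw [div_le_one hr0]; exact hr1
        have h4 : ∀ e : ℝ, |e| ≤ 1 → |(s + e) / r| ≤ |s| / r + 1 := by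
          intro e he
          rw [abs_div, abs_of_pos hr0]
          calc |s + e| / r ≤ (|s| + 1) / r := by
                gcongr; exact (abs_add_le s e).trans (by linarith)
            _ = |s| / r + 1 / r := add_div _ _ _
            _ ≤ _ := by linarith
        exact max_le (h4 (-1) (by simp)) (h4 1 (by simp))
      rw [h1]
      calc (2 * max |(s - 1) / r| |(s + 1) / r| + 6) * (2 / r) ≤
          (2 * (|s| / r + 1) + 6) * (2 / r) := by gcongr
        _ = 4 / (r * r) * |s| + 16 / r := by field_simp; ring
    · have : (s - 1) / r ≤ z ∧ z ≤ (s + 1) / r ↔ |s - z * r| ≤ 1 := by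
        rw [div_le_iff₀ hr0, le_div_iff₀ hr0, abs_le]
        constructor <;> rintro ⟨h1, h2⟩ <;> constructor <;> linarith
      simp only [this, mul_ite, mul_one, mul_zero]
  refine (abs_walk_le m hbound).trans ?_
  rw [walk_add, walk_add, walk_const_mul, walk_const_mul, walk_const]
  have h1 := walk_near_le m (z * r)
  have h2 : walk m (fun s => |s|) ≤ r := (walk_abs_le m).trans (Real.sqrt_le_sqrt (by linarith))
  have h3 : 4 / (r * r) * walk m (fun s => |s|) ≤ 4 / r := by
    calc 4 / (r * r) * walk m (fun s => |s|) ≤ 4 / (r * r) * r := by gcongr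
      _ = 4 / r := by field_simp
  rw [← hr] at h1
  have h4 : 36 / r = 4 / r + 16 / r + 4 * (2 / r) + 8 / r := by ring
  have h5 : 0 ≤ 8 / r := by positivity
  linarith

/-! ### Transfer to the Horton–Strahler number -/

lemma abs_gaussCdf_sub_le_of_forall {x y c : ℝ}
    (h : ∀ t ∈ Set.uIcc x y, gaussDensity t ≤ c) :
    |gaussCdf y - gaussCdf x| ≤ c * |y - x| := by
  refine Convex.norm_image_sub_le_of_norm_hasDerivWithin_le (s := Set.uIcc x y)
    (fun t _ => (hasDerivAt_gaussCdf t).hasDerivWithinAt) (fun t ht => ?_) (convex_uIcc x y)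
    Set.left_mem_uIcc Set.right_mem_uIcc
  rw [Real.norm_of_nonneg (gaussDensity_pos t).le]
  exact h t ht

lemma abs_gaussCdf_sub_le (x y : ℝ) : |gaussCdf y - gaussCdf x| ≤ |y - x| := by
  simpa using abs_gaussCdf_sub_le_of_forall (c := 1) fun t (_ : t ∈ Set.uIcc x y) =>
    gaussDensity_le_one t

/-- Every point between `x` and `r * x` has modulus at least `|x| / 2`. The exponential factor is
kept because `r - 1` will itself be of order `|x| / √n`. -/
lemma abs_gaussCdf_mul_sub_le {r : ℝ} (hr : 1 / 2 ≤ r) (x : ℝ) :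
    |gaussCdf (r * x) - gaussCdf x| ≤ |r - 1| * (|x| * Real.exp (-x ^ 2 / 8)) := by
  have h : ∀ t ∈ Set.uIcc x (r * x), gaussDensity t ≤ Real.exp (-x ^ 2 / 8) := by
    intro t ht
    refine (gaussDensity_le_exp t).trans (Real.exp_le_exp.2 ?_)
    have : (x / 2) ^ 2 ≤ t ^ 2 := by
      rw [sq_le_sq]
      rw [Set.mem_uIcc] at ht
      rcases le_total 0 x with h0 | h0
      · rw [abs_of_nonneg (by linarith)]
        refine le_trans ?_ (le_abs_self t)
        rcases ht with ht | ht <;> nlinarith [ht.1]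
      · rw [abs_of_nonpos (by linarith)]
        refine le_trans ?_ (neg_le_abs t)
        rcases ht with ht | ht <;> nlinarith [ht.2]
    nlinarith
  refine (abs_gaussCdf_sub_le_of_forall h).trans (le_of_eq ?_)
  rw [show r * x - x = (r - 1) * x by ring, abs_mul]
  ring

lemma sq_mul_exp_le (x : ℝ) : x ^ 2 * Real.exp (-x ^ 2 / 8) ≤ 8 := by
  have h := Real.add_one_le_exp (x ^ 2 / 8)
  rw [neg_div, Real.exp_neg, ← div_eq_mul_inv, div_le_iff₀ (Real.exp_pos _)]
  linarith

lemma abs_mul_exp_le (x : ℝ) : |x| * Real.exp (-x ^ 2 / 8) ≤ 2 := by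
  have h := Real.add_one_le_exp (x ^ 2 / 8)
  rw [neg_div, Real.exp_neg, ← div_eq_mul_inv, div_le_iff₀ (Real.exp_pos _)]
  nlinarith [sq_nonneg (|x| - 2), sq_abs x]

lemma abs_gaussCdf_mul_sub_le_two_mul (r x : ℝ) :
    |gaussCdf (r * x) - gaussCdf x| ≤ 2 * |r - 1| := by
  rcases le_total (1 / 2) r with h | h
  · refine (abs_gaussCdf_mul_sub_le h x).trans ?_
    rw [mul_comm 2]
    exact mul_le_mul_of_nonneg_left (abs_mul_exp_le x) (abs_nonneg _)
  · have h1 := gaussCdf_nonneg (r * x)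
    have h2 := gaussCdf_le_one (r * x)
    have h3 := gaussCdf_nonneg x
    have h4 := gaussCdf_le_one x
    rw [abs_of_nonpos (show r - 1 ≤ 0 by linarith), abs_le]
    constructor <;> linarith

lemma abs_sub_one_le_abs_sq_sub_one {r : ℝ} (hr : 0 ≤ r) : |r - 1| ≤ |r ^ 2 - 1| := by
  rw [show r ^ 2 - 1 = (r - 1) * (r + 1) by ring, abs_mul,
    abs_of_nonneg (show 0 ≤ r + 1 by linarith)]
  nlinarith [abs_nonneg (r - 1)]

/-- Normal approximation of the tail probabilities, with the asymptotic mean and variance. -/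
lemma abs_one_sub_measureReal_le_HS_sub_le {n : ℕ} (hn : 2 ≤ n) (k : ℕ) :
    |1 - (bits n).real {x | (k : ℝ) ≤ HS n x} - gaussCdf ((3 * k - n) / √(2 * n / 3))| ≤
      80 / √n := by
  have hn' : (2 : ℝ) ≤ n := by exact_mod_cast hn
  have hsn : 0 < √(n : ℝ) := Real.sqrt_pos.2 (by linarith)
  have hsn2 : √(n : ℝ) * √n = n := Real.mul_self_sqrt (by linarith)
  set q : ℝ := √(2 * n / 3) with hq
  have hq0 : 0 < q := Real.sqrt_pos.2 (by positivity)
  have hq2 : q ^ 2 = 2 * n / 3 := Real.sq_sqrt (by positivity)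
  have hqn : q ≤ √n := Real.sqrt_le_sqrt (by linarith)
  set y : ℝ := (3 * k - n) / q with hy
  have hyq : y * q = 3 * k - n := div_mul_cancel₀ _ hq0.ne'
  rcases le_or_gt (2 * k) n with hk | hk
  · have hkn : (2 : ℝ) * k ≤ n := by exact_mod_cast hk
    obtain ⟨m, hm⟩ : ∃ m, n - k = m + 1 := ⟨n - k - 1, by omega⟩
    have hm' : (m : ℝ) + 1 = n - k := by
      rw [← Nat.cast_sub (by omega), hm]; push_cast; rfl
    rw [measureReal_le_HS_eq_walkTail (by omega), hm]
    set p : ℝ := √((m : ℝ) + 1) with hp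
    have hp2 : p ^ 2 = n - k := by rw [hp, Real.sq_sqrt (by positivity), hm']
    have hp0 : 0 < p := Real.sqrt_pos.2 (by positivity)
    have hpn : √n ≤ 2 * p := by
      rw [← abs_of_pos hsn, ← abs_of_pos (show 0 < 2 * p by linarith), ← sq_le_sq]
      nlinarith
    have h1 : walkTail (m + 1) k =
        walk (m + 1) (fun s => if s / p ≤ -(q / p * y) then 1 else 0) := by
      have : ∀ s : ℝ, s ≤ (m + 1 : ℕ) - 2 * k ↔ s / p ≤ -(q / p * y) := by
        intro s
        rw [div_le_iff₀ hp0, show -(q / p * y) * p = -(y * q) by field_simp, hyq]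
        push_cast
        constructor <;> intro <;> linarith
      simp only [walkTail, this]
    have h2 := abs_walk_sub_gaussCdf_le m (-(q / p * y))
    rw [← hp, ← h1, gaussCdf_neg] at h2
    -- The walk has variance `p ^ 2 = n - k` instead of `q ^ 2 = 2 * n / 3`; the relative error is
    -- proportional to the deviation `y`.
    have h3 : |q / p - 1| ≤ |y| / √n := by
      refine (abs_sub_one_le_abs_sq_sub_one (by positivity)).trans ?_
      have e : (q / p) ^ 2 - 1 = y * (q / (3 * p ^ 2)) := by
        rw [← mul_div_assoc, hyq, div_pow, hq2, hp2]
        have : (n : ℝ) - k ≠ 0 := by rw [← hp2]; positivity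
        field_simp; ring
      rw [e, abs_mul, div_eq_mul_inv |y|]
      refine mul_le_mul_of_nonneg_left ?_ (abs_nonneg _)
      rw [abs_of_nonneg (by positivity), div_le_iff₀ (by positivity), inv_mul_eq_div,
        le_div_iff₀ hsn]
      nlinarith
    have h4 : 1 / 2 ≤ q / p := by
      rw [le_div_iff₀ hp0, ← abs_of_pos hq0, ← abs_of_pos (show 0 < 1 / 2 * p by linarith),
        ← sq_le_sq]
      nlinarith [k.cast_nonneg (α := ℝ)]
    have h5 : |gaussCdf (q / p * y) - gaussCdf y| ≤ 8 / √n := by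
      refine (abs_gaussCdf_mul_sub_le h4 y).trans ?_
      calc |q / p - 1| * (|y| * Real.exp (-y ^ 2 / 8)) ≤
          |y| / √n * (|y| * Real.exp (-y ^ 2 / 8)) := by gcongr
        _ = (y ^ 2 * Real.exp (-y ^ 2 / 8)) / √n := by rw [← sq_abs y]; ring
        _ ≤ 8 / √n := by gcongr; exact sq_mul_exp_le y
    have h6 : 36 / p ≤ 72 / √n := by
      rw [div_le_div_iff₀ hp0 hsn]; linarith
    have h7 : 80 / √(n : ℝ) = 72 / √n + 8 / √n := by ring
    rw [abs_le] at h2 h5 ⊢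
    constructor <;> linarith
  · have hkn : (n : ℝ) < 2 * k := by exact_mod_cast hk
    rw [measureReal_le_HS_eq_zero hk, sub_zero,
      abs_of_nonneg (sub_nonneg.2 (gaussCdf_le_one y))]
    -- The tail is exactly 0 here, and `y` is so large that the Mills ratio bound makes the normal
    -- tail at most `2 / √n`.
    have hyn : √n ≤ 2 * y := by
      refine le_of_mul_le_mul_right ?_ hq0
      nlinarith
    have h1 := (mul_one_sub_gaussCdf_le y).trans (gaussDensity_le_one y)
    rw [le_div_iff₀ hsn]
    nlinarith [sub_nonneg.2 (gaussCdf_le_one y)]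

/-- Normal approximation of the tail probabilities, with the exact mean and variance. -/
lemma abs_one_sub_measureReal_le_HS_sub_le' {n : ℕ} (hn : 2 ≤ n) {k : ℕ} {t : ℝ}
    (hkt : |(k : ℝ) - t| ≤ 1) :
    |1 - (bits n).real {x | (k : ℝ) ≤ HS n x} - gaussCdf ((t - mean n) / sd n)| ≤ 120 / √n := by
  have hn' : (2 : ℝ) ≤ n := by exact_mod_cast hn
  have hsn : 1 ≤ √(n : ℝ) := Real.one_le_sqrt.2 (by linarith)
  have hsn2 : √(n : ℝ) ^ 2 = n := Real.sq_sqrt (by linarith)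
  set s : ℝ := √(2 * n / 3) / 3 with hs
  have hs0 : 0 < s := by positivity
  have hs2 : s ^ 2 = 2 * n / 27 := by rw [hs, div_pow, Real.sq_sqrt (by positivity)]; ring
  have hsd := sd_pos hn
  have hsd2 : sd n ^ 2 = variance (HS n) (bits n) := Real.sq_sqrt (variance_nonneg _ _)
  set y : ℝ := (3 * k - n) / √(2 * n / 3) with hy
  set x : ℝ := (t - mean n) / sd n with hx
  have hxs : sd n / s * x * s = t - mean n := by rw [hx]; field_simp
  have hys : y * s = k - n / 3 := by rw [hy, hs]; field_simp
  have hsn4 : √n ≤ 4 * s := by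
    rw [← abs_of_pos (show 0 < √(n : ℝ) by linarith), ← abs_of_pos (show 0 < 4 * s by linarith),
      ← sq_le_sq]
    nlinarith
  have h1 := abs_one_sub_measureReal_le_HS_sub_le hn k
  rw [← hy] at h1
  -- The shift costs at most 1 for `k` against `t` and 1 for the mean; dividing by `s ≥ √n / 4`
  -- gives 8.
  have h2 : |gaussCdf y - gaussCdf (sd n / s * x)| ≤ 8 / √n := by
    refine (abs_gaussCdf_sub_le _ _).trans ?_
    have h3 : |y - sd n / s * x| * s ≤ 2 := by
      rw [← abs_of_pos hs0, ← abs_mul, abs_of_pos hs0, sub_mul, hys, hxs,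
        show (k : ℝ) - n / 3 - (t - mean n) = (k - t) + (mean n - n / 3) by ring]
      exact (abs_add_le _ _).trans (by linarith [abs_mean_sub_le n])
    rw [le_div_iff₀ (by linarith)]
    nlinarith [abs_nonneg (y - sd n / s * x)]
  have h4 : |gaussCdf (sd n / s * x) - gaussCdf x| ≤ 32 / √n := by
    refine (abs_gaussCdf_mul_sub_le_two_mul _ x).trans ?_
    have h5 : |sd n / s - 1| ≤ 1 / s ^ 2 := by
      refine (abs_sub_one_le_abs_sq_sub_one (by positivity)).trans ?_
      rw [div_pow, div_sub_one (by positivity), abs_div, abs_of_pos (show 0 < s ^ 2 by positivity),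
        hsd2]
      gcongr
      rw [hs2]
      exact abs_variance_sub_le n
    have h6 : 1 / s ^ 2 ≤ 16 / √n := by
      rw [div_le_div_iff₀ (by positivity) (by linarith)]
      nlinarith
    calc 2 * |sd n / s - 1| ≤ 2 * (16 / √n) := by gcongr; exact h5.trans h6
      _ = 32 / √n := by ring
  have h7 : 120 / √(n : ℝ) = 80 / √n + 8 / √n + 32 / √n := by ring
  rw [abs_le] at h1 h2 h4 ⊢
  constructor <;> linarith

/-- The Berry-Esseen bound for the Horton-Strahler number. -/
theorem abs_measureReal_Z_le_sub_le {n : ℕ} (hn : 2 ≤ n) (x : ℝ) :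
    |(bits n).real {b | Z n b ≤ x} - gaussCdf x| ≤ 120 / √n := by
  have hsd := sd_pos hn
  set t : ℝ := mean n + sd n * x with ht
  have hset : {b | Z n b ≤ x} = {b | HS n b ≤ t} := by
    ext b
    simp only [Set.mem_ofPred_eq, Z, div_le_iff₀ hsd, ht]
    constructor <;> intro <;> linarith
  have hxt : (t - mean n) / sd n = x := by rw [ht]; field_simp; ring
  rw [hset]
  rcases lt_or_ge t 0 with h0 | h0
  · have he : {b | HS n b ≤ t} = ∅ := by
      ext b
      simp only [Set.mem_ofPred_eq, Set.mem_empty_iff_false, iff_false, not_le]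
      exact h0.trans_le (Nat.cast_nonneg _)
    -- For negative `t` the event is empty; the estimate at `t = 0`, where the tail probability is
    -- 1, bounds the normal mass to the left.
    have h1 := abs_one_sub_measureReal_le_HS_sub_le' hn (k := 0) (t := 0) (by simp)
    have h2 : {x | ((0 : ℕ) : ℝ) ≤ HS n x} = Set.univ := by
      ext b
      simp [HS]
    rw [h2, probReal_univ, sub_self, zero_sub, abs_neg, abs_of_nonneg (gaussCdf_nonneg _)] at h1
    rw [he, measureReal_empty, zero_sub, abs_neg, abs_of_nonneg (gaussCdf_nonneg _)]
    refine (gaussCdf_mono ?_).trans h1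
    rw [← hxt]
    gcongr
  · have h1 := abs_one_sub_measureReal_le_HS_sub_le' hn (k := ⌊t⌋₊ + 1) (t := t) (by
      have h2 := Nat.floor_le h0
      have h3 := Nat.lt_floor_add_one t
      push_cast
      rw [abs_le]; constructor <;> linarith)
    rw [hxt] at h1
    have he : {b | HS n b ≤ t} = {b | ((⌊t⌋₊ + 1 : ℕ) : ℝ) ≤ HS n b}ᶜ := by
      ext b
      simp only [Set.mem_ofPred_eq, Set.mem_compl_iff, HS, Nat.cast_le, not_le, Nat.lt_succ_iff,
        Nat.le_floor_iff h0]
    rwa [he, probReal_compl_eq_one_sub .of_discrete]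

/-! ### Convergence in distribution -/

/-- Pointwise convergence of the distribution functions of real probability measures implies weak
convergence. -/
lemma tendsto_of_tendsto_measureReal_Iic {ι : Type*} {l : Filter ι} [l.IsCountablyGenerated]
    {μ : ι → ProbabilityMeasure ℝ} {ν : ProbabilityMeasure ℝ}
    (h : ∀ x, Tendsto (fun i => (μ i : Measure ℝ).real (Set.Iic x)) l
      (nhds ((ν : Measure ℝ).real (Set.Iic x)))) : Tendsto μ l (nhds ν) := by
  -- Half-open intervals form a π-system containing small neighbourhoods of every point, and their
  -- masses are differences of values of the distribution function.
  have hS : IsPiSystem {s : Set ℝ | ∃ a b, s = Set.Ioc a b} := by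
    rintro _ ⟨a, b, rfl⟩ _ ⟨c, d, rfl⟩ -
    exact ⟨_, _, Set.Ioc_inter_Ioc⟩
  refine hS.tendsto_probabilityMeasure_of_tendsto_of_mem ?_ ?_ ?_
  · rintro _ ⟨a, b, rfl⟩
    exact measurableSet_Ioc
  · intro u hu x hx
    obtain ⟨e, he, hsub⟩ := Metric.isOpen_iff.1 hu x hx
    refine ⟨_, ⟨x - e / 2, x + e / 2, rfl⟩, Ioc_mem_nhds (by linarith) (by linarith),
      fun y hy => hsub ?_⟩
    rw [Metric.mem_ball, Real.dist_eq, abs_lt]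
    constructor <;> linarith [hy.1, hy.2]
  · rintro _ ⟨a, b, rfl⟩
    rw [← NNReal.tendsto_coe]
    change Tendsto (fun i => (μ i : Measure ℝ).real (Set.Ioc a b)) l
      (nhds ((ν : Measure ℝ).real (Set.Ioc a b)))
    rcases le_total b a with hab | hab
    · simpa [Set.Ioc_eq_empty_of_le hab] using tendsto_const_nhds
    · have key : ∀ ρ : ProbabilityMeasure ℝ, (ρ : Measure ℝ).real (Set.Ioc a b) =
          (ρ : Measure ℝ).real (Set.Iic b) - (ρ : Measure ℝ).real (Set.Iic a) := by
        intro ρ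
        rw [← Set.Iic_sdiff_Iic, measureReal_sdiff (Set.Iic_subset_Iic.2 hab) measurableSet_Iic]
      simp only [key]
      exact (h b).sub (h a)

theorem tendstoInDistribution_Z :
    TendstoInDistribution Z atTop (id : ℝ → ℝ) bits (gaussianReal 0 1) where
  forall_aemeasurable n := (measurable_of_finite _).aemeasurable
  tendsto := by
    refine tendsto_of_tendsto_measureReal_Iic fun x => ?_
    have h1 : ∀ n, ((bits n).map (Z n)).real (Set.Iic x) = (bits n).real {b | Z n b ≤ x} :=
      fun n => map_measureReal_apply (measurable_of_finite _) measurableSet_Iic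
    simp only [ProbabilityMeasure.coe_mk, h1, Measure.map_id, ← cdf_eq_real]
    have h2 : Tendsto (fun n : ℕ => 120 / √(n : ℝ)) atTop (nhds 0) :=
      (Real.tendsto_sqrt_atTop.comp tendsto_natCast_atTop_atTop).const_div_atTop 120
    rw [tendsto_iff_norm_sub_tendsto_zero]
    refine squeeze_zero' (Eventually.of_forall fun n => norm_nonneg _) ?_ h2
    filter_upwards [eventually_ge_atTop 2] with n hn using abs_measureReal_Z_le_sub_le hn x

end Butterfly

theorem mainTheorem6 :
    (∀ n : ℕ, 2 ≤ n → 0 < Butterfly.sd n) ∧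
    TendstoInDistribution Butterfly.Z atTop (id : ℝ → ℝ) Butterfly.bits (gaussianReal 0 1) ∧
    ∃ C : ℝ, ∀ n : ℕ, 2 ≤ n →
      ⨆ x : ℝ, |(Butterfly.bits n).real {b | Butterfly.Z n b ≤ x} - cdf (gaussianReal 0 1) x|
        ≤ C / √(n : ℝ) :=
  ⟨fun _ hn => Butterfly.sd_pos hn, Butterfly.tendstoInDistribution_Z, 120, fun _ hn =>
    ciSup_le fun x => Butterfly.abs_measureReal_Z_le_sub_le hn x⟩
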